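/- A group $G$ is a Jordan group if there is an integer $d>0$ such that every finite subgroup $H\le G$ contains an abelian normal subgroup of $H$ of index at most $d$ in $H$; the least such $d$ is the Jordan constant $J_G$. Let $\mathcal D$ be a quaternion division algebra over $\mathbb Q$, that is, a division algebra with centre $\mathbb Q$ and $\dim_{\mathbb Q}\mathcal D=4$. Let $R_{\mathcal D}$ be the set of places $v$ of $\mathbb Q$ (primes and $\infty$) at which $\mathcal D$ is ramified, i.e. for which $\mathbb Q_v\otimes_{\mathbb Q}\mathcal D$ is a division algebra, where $\mathbb Q_\infty=\mathbb R$. Then $\mathcal D^\times$ is a Jordan group, and \[ J_{\mathcal D^\times}=12 \iff R_{\mathcal D}=\{2,\infty\},\qquad J_{\mathcal D^\times}=2 \iff R_{\mathcal D}=\{3,\infty\}, \] and $J_{\mathcal D^\times}=1$ if and only if $R_{\mathcal D}$ is neither $\{2,\infty\}$ nor $\{3,\infty\}$. Moreover, every finite subgroup of $\mathcal D^\times$ is isomorphic to the binary tetrahedral group $\mathfrak T^*$ (of order $24$), to the dicyclic group $\mathrm{Dic}_{12}$ of order $12$, to the quaternion group $Q_8$, or is cyclic. -/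

import Mathlib

open scoped TensorProduct Quaternion

/-- Every finite subgroup of `G` contains an abelian normal subgroup of index at most `d`. -/
def IsJordanBound (G : Type*) [Group G] (d : ℕ) : Prop :=
  ∀ H : Subgroup G, Finite H →
    ∃ A : Subgroup H, A.Normal ∧ (∀ x ∈ A, ∀ y ∈ A, x * y = y * x) ∧ A.index ≤ d

/-- `G` is a Jordan group. -/
def IsJordanGroup (G : Type*) [Group G] : Prop :=
  ∃ d : ℕ, 0 < d ∧ IsJordanBound G d

/-- The Jordan constant of `G`: the least positive Jordan bound (meaningful for Jordan groups). -/
noncomputable def jordanConstant (G : Type*) [Group G] : ℕ :=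
  sInf {d : ℕ | 0 < d ∧ IsJordanBound G d}

/-- The places of `ℚ`: the primes and the infinite place. -/
inductive RatPlace : Type
  | finite (p : ℕ) (hp : p.Prime) : RatPlace
  | infinite : RatPlace

/-- The base change `K ⊗ D` is a division ring: each nonzero element is invertible. -/
def IsDivisionOver (K : Type*) [Field K] [Algebra ℚ K]
    (D : Type*) [Ring D] [Algebra ℚ D] : Prop :=
  ∀ x : K ⊗[ℚ] D, x ≠ 0 → IsUnit x

/-- A quaternion algebra over `ℚ` is ramified at a place `v` if it remains a division algebra
over the completion of `ℚ` at `v`, which is `ℚ_[p]` or `ℝ`. -/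
def IsRamifiedAt (D : Type*) [Ring D] [Algebra ℚ D] : RatPlace → Prop
  | .finite p hp => haveI : Fact p.Prime := ⟨hp⟩; IsDivisionOver ℚ_[p] D
  | .infinite => IsDivisionOver ℝ D

/-- The set of places of `ℚ` at which `D` is ramified. -/
def ramificationSet (D : Type*) [Ring D] [Algebra ℚ D] : Set RatPlace :=
  {v | IsRamifiedAt D v}

/-- The prime `2` as a place of `ℚ`. -/
def placeTwo : RatPlace := .finite 2 Nat.prime_two

/-- The prime `3` as a place of `ℚ`. -/
def placeThree : RatPlace := .finite 3 Nat.prime_three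

/-- The quaternion `q` lies in the Hurwitz order `ℤ + ℤ i + ℤ j + ℤ (1 + i + j + k) / 2`. -/
def IsHurwitz (q : ℍ[ℚ]) : Prop :=
  ∃ a b c d : ℤ, q.re = a + d / 2 ∧ q.imI = b + d / 2 ∧ q.imJ = c + d / 2 ∧ q.imK = d / 2

theorem IsHurwitz.mul {p q : ℍ[ℚ]} (hp : IsHurwitz p) (hq : IsHurwitz q) :
    IsHurwitz (p * q) := by
  obtain ⟨a, b, c, d, h0, h1, h2, h3⟩ := hp
  obtain ⟨a', b', c', d', h0', h1', h2', h3'⟩ := hq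
  refine ⟨a * a' - b * b' - b * c' - b * d' + c * b' - c * c' - d * c' - d * d',
    a * b' + b * a' - b * c' + c * b' + c * d' + d * b' - d * c',
    a * c' - b * c' - b * d' + c * a' + c * b' + c * d' + d * b',
    a * d' + 2 * b * c' + b * d' - 2 * c * b' - c * d' + d * a' - d * b' + d * c' + d * d', ?_⟩
  simp only [Quaternion.re_mul, Quaternion.imI_mul, Quaternion.imJ_mul, Quaternion.imK_mul,
    h0, h1, h2, h3, h0', h1', h2', h3']
  push_cast
  refine ⟨?_, ?_, ?_, ?_⟩ <;> ring

/-- The binary tetrahedral group, as the group of the 24 Hurwitz quaternions of norm `1`: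
`±1, ±i, ±j, ±k` and `(±1 ± i ± j ± k) / 2`. -/
def binaryTetrahedralGroup : Subgroup ℍ[ℚ]ˣ where
  carrier := {u | IsHurwitz (u : ℍ[ℚ]) ∧ Quaternion.normSq (u : ℍ[ℚ]) = 1}
  one_mem' := by
    refine ⟨⟨1, 0, 0, 0, ?_⟩, by simp⟩
    simp
  mul_mem' := by
    rintro u v ⟨hu, hu'⟩ ⟨hv, hv'⟩
    exact ⟨by simpa using hu.mul hv, by simp [hu', hv']⟩
  inv_mem' := by
    rintro u ⟨⟨a, b, c, d, h0, h1, h2, h3⟩, hu'⟩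
    have hs : ((u⁻¹ : ℍ[ℚ]ˣ) : ℍ[ℚ]) = star (u : ℍ[ℚ]) := by
      apply Units.inv_eq_of_mul_eq_one_right
      rw [Quaternion.self_mul_star, hu', Quaternion.coe_one]
    refine ⟨⟨a + d, -b, -c, -d, ?_⟩, ?_⟩
    · simp only [hs, Quaternion.re_star, Quaternion.imI_star, Quaternion.imJ_star,
        Quaternion.imK_star, h0, h1, h2, h3]
      push_cast
      refine ⟨?_, ?_, ?_, ?_⟩ <;> ring
    · rw [hs, Quaternion.normSq_star, hu']

/-! Every element of `D` is quadratic over `ℚ`, so an element of finite order is a root of a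
cyclotomic polynomial of degree at most two, and its reduced trace is an integer in `[-2, 2]`. The
finite groups `G` are classified by these traces alone (`finite_subgroup_classification`). If `G`
has `x, y` with `x`, `y`, `x y` of trace `0`, then `x, y` are anticommuting square roots of `-1`. So
`D = (-1, -1)`, integrality of traces places `G` among the 24 Hurwitz units, and `G` contains `Q₈`,
so its order is 8 or 24. Otherwise the identity `tr(xy) + tr(xy⁻¹) = tr x tr y` makes elements of
order three commute. A nonabelian `G` then has an element `ω` of order three whose centralizer `{±ω
^ k}` has index two; `G` is dicyclic of order 12 and yields a basis of type `(-1, -3)`. An abelian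
`G` lies in a commutative domain and is cyclic. Abelian normal subgroups of the group of order 24
lie in `{±1}`, which gives 12; the dicyclic groups have a cyclic subgroup of index two.

It remains to show that `{2, ∞}` characterizes `(-1, -1)` and `{3, ∞}` characterizes `(-1, -3)`.
Ramification means anisotropy of the norm form (`QuaternionAlgebra.Basis.isDivisionOver_iff`), so
the two ramification sets are computed by hand. The converse avoids the local-global principle
(`hasQuaternionBasis_of_definite`). If `D` is definite and split outside 2 and 3, splitting gives
quadratic residue conditions. These cut out a lattice on which a multiple of the pure norm form
becomes integral of determinant `e`, where `e` is 1 or 3. Hermite's bound makes it represent 1, so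
`D` contains `√-e` (`exists_ternary_solution`, `exists_mul_self_eq_neg`). Then `D = (-e, -n)`, and
the part of `n` prime to 6 is removed because it is a norm from `ℚ(√-e)`. Only the two algebras
above survive, and their ramification sets differ. -/

/-! ### Four-dimensional central division algebras as quaternion algebras, and their norm forms. -/

section Structure

open QuaternionAlgebra (Basis)

variable {D : Type*} [Ring D] [IsDomain D] [Algebra ℚ D]

/-- If nonzero `i`, `j` anticommute, then `1, i, j, ij` are linearly independent. -/
theorem coeffs_eq_zero_of_anticommute {i j : D} (hj : j ≠ 0) (hi : i ≠ 0) (hij : j * i = -(i * j))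
    {x y z w : ℚ} (h : algebraMap ℚ D x + y • i + z • j + w • (i * j) = 0) :
    x = 0 ∧ y = 0 ∧ z = 0 ∧ w = 0 := by
  have : CharZero D := algebraRat.charZero D
  have key : ∀ x y : ℚ, algebraMap ℚ D x + y • i = 0 → x = 0 ∧ y = 0 := by
    intro x y h
    have h1 : j * (algebraMap ℚ D x + y • i) = (algebraMap ℚ D x - y • i) * j := by
      rw [mul_add, mul_smul_comm, hij, ← Algebra.commutes, sub_mul, smul_mul_assoc, smul_neg,
        sub_eq_add_neg]
    rw [h, mul_zero] at h1
    have h2 : algebraMap ℚ D x - y • i = 0 := (mul_eq_zero.1 h1.symm).resolve_right hj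
    have h3 : (2 * y) • i = 0 := by
      have := congrArg₂ (· - ·) h h2
      simp only [sub_zero] at this
      rw [← this]; module
    have hy : y = 0 := by simpa [hi] using h3
    subst hy
    simpa using h
  -- Conjugation by `i` fixes the span of `1, i` and negates that of `j, ij`, so the relation splits
  -- into two halves.
  have h1 : (algebraMap ℚ D x + y • i + z • j + w • (i * j)) * i =
      i * (algebraMap ℚ D x + y • i - (z • j + w • (i * j))) := by
    simp only [add_mul, mul_add, mul_sub, smul_mul_assoc, mul_smul_comm, ← Algebra.commutes,
      hij, mul_assoc, mul_neg, smul_neg]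
    abel
  rw [h, zero_mul] at h1
  have h2 := (mul_eq_zero.1 h1.symm).resolve_left hi
  have h3 : (2 : ℚ) • (algebraMap ℚ D x + y • i) = 0 := by
    have := congrArg₂ (· + ·) h h2
    simp only [add_zero] at this
    rw [← this]; module
  have h4 := (smul_eq_zero.1 h3).resolve_left two_ne_zero
  have h5 : (algebraMap ℚ D z + w • i) * j = 0 := by
    have h6 := h
    rw [h4, zero_add] at h6
    rw [add_mul, smul_mul_assoc, ← Algebra.smul_def, h6]
  have h6 := (mul_eq_zero.1 h5).resolve_right hj
  exact ⟨(key x y h4).1, (key x y h4).2, (key z w h6).1, (key z w h6).2⟩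

/-- Elements `1, i, j, ij` with `i`, `j` anticommuting span a four-dimensional algebra. -/
theorem exists_coeffs_of_anticommute (hD : Module.finrank ℚ D = 4) {i j : D} (hj : j ≠ 0)
    (hi : i ≠ 0) (hij : j * i = -(i * j)) (d : D) :
    ∃ x y z w : ℚ, d = algebraMap ℚ D x + y • i + z • j + w • (i * j) := by
  have : FiniteDimensional ℚ D := Module.finite_of_finrank_eq_succ hD
  let f : (Fin 4 → ℚ) →ₗ[ℚ] D := Fintype.linearCombination ℚ ![1, i, j, i * j]
  have hf : ∀ v, f v = algebraMap ℚ D (v 0) + v 1 • i + v 2 • j + v 3 • (i * j) := by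
    intro v
    simp [f, Fintype.linearCombination_apply, Fin.sum_univ_four, Algebra.algebraMap_eq_smul_one]
  have hinj : Function.Injective f := by
    rw [injective_iff_map_eq_zero]
    intro v hv
    rw [hf] at hv
    obtain ⟨h0, h1, h2, h3⟩ := coeffs_eq_zero_of_anticommute hj hi hij hv
    ext k
    fin_cases k <;> assumption
  have hsurj := (LinearMap.injective_iff_surjective_of_finrank_eq_finrank
    (by simp [hD])).1 hinj
  obtain ⟨v, hv⟩ := hsurj d
  exact ⟨v 0, v 1, v 2, v 3, by rw [← hv, hf]⟩

theorem QuaternionAlgebra.Basis.i_ne_zero {a b : ℚ} (q : Basis D a 0 b) (ha : a ≠ 0) :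
    q.i ≠ 0 := by
  intro h
  have := q.i_mul_i
  rw [h, mul_zero, smul_zero, add_zero, eq_comm, smul_eq_zero] at this
  simp [ha] at this

theorem QuaternionAlgebra.Basis.j_ne_zero {a b : ℚ} (q : Basis D a 0 b) (hb : b ≠ 0) :
    q.j ≠ 0 := by
  intro h
  have := q.j_mul_j
  rw [h, mul_zero, eq_comm, smul_eq_zero] at this
  simp [hb] at this

theorem QuaternionAlgebra.Basis.j_mul_i' {A : Type*} [Ring A] [Algebra ℚ A] {a b : ℚ}
    (q : Basis A a 0 b) : q.j * q.i = -(q.i * q.j) := by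
  simp

/-- The quaternion basis given by two anticommuting elements with scalar squares. -/
def quaternionBasis {A : Type*} [Ring A] [Algebra ℚ A] {i j : A} {a b : ℚ}
    (hi : i * i = algebraMap ℚ A a) (hj : j * j = algebraMap ℚ A b) (hij : j * i = -(i * j)) :
    Basis A a 0 b where
  i := i
  j := j
  k := i * j
  i_mul_i := by rw [hi, Algebra.algebraMap_eq_smul_one]; simp
  j_mul_j := by rw [hj, Algebra.algebraMap_eq_smul_one]
  i_mul_j := rfl
  j_mul_i := by rw [hij]; simp

/-- A quaternion basis identifies a four-dimensional division algebra with a quaternion algebra. -/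
theorem QuaternionAlgebra.Basis.liftHom_bijective (hD : Module.finrank ℚ D = 4) {a b : ℚ}
    (q : Basis D a 0 b) (ha : a ≠ 0) (hb : b ≠ 0) : Function.Bijective q.liftHom := by
  have : FiniteDimensional ℚ D := Module.finite_of_finrank_eq_succ hD
  have hinj : Function.Injective q.liftHom := by
    rw [injective_iff_map_eq_zero]
    intro x hx
    have hx' : algebraMap ℚ D x.re + x.imI • q.i + x.imJ • q.j + x.imK • (q.i * q.j) = 0 := by
      rw [q.i_mul_j]; exact hx
    obtain ⟨h0, h1, h2, h3⟩ :=
      coeffs_eq_zero_of_anticommute (q.j_ne_zero hb) (q.i_ne_zero ha) q.j_mul_i' hx'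
    ext <;> assumption
  refine ⟨hinj, ?_⟩
  exact (LinearMap.injective_iff_surjective_of_finrank_eq_finrank
    (f := q.liftHom.toLinearMap) (by rw [hD, QuaternionAlgebra.finrank_eq_four])).1 hinj

theorem mem_range_algebraMap_of_forall_commute {D : Type*} [Ring D] [Algebra ℚ D]
    [Algebra.IsCentral ℚ D] {x : D}
    (h : ∀ y, y * x = x * y) : ∃ a : ℚ, x = algebraMap ℚ D a := by
  have : x ∈ Subalgebra.center ℚ D := Subalgebra.mem_center_iff.2 h
  rw [Algebra.IsCentral.center_eq_bot, Algebra.mem_bot] at this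
  obtain ⟨a, ha⟩ := this
  exact ⟨a, ha.symm⟩

/-- Moving `i` past `j * j` changes the sign twice, so `j * j` commutes with `i` and `j`, hence with
everything, and is rational. -/
theorem exists_basis_of_anticommute [Algebra.IsCentral ℚ D] (hD : Module.finrank ℚ D = 4)
    {i j : D} {a : ℚ} (hi : i * i = algebraMap ℚ D a) (ha : a ≠ 0) (hj : j ≠ 0)
    (hij : j * i = -(i * j)) : ∃ b : ℚ, b ≠ 0 ∧ j * j = algebraMap ℚ D b := by
  have hi0 : i ≠ 0 := by
    rintro rfl
    rw [mul_zero, eq_comm, map_eq_zero_iff _ (algebraMap ℚ D).injective] at hi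
    exact ha hi
  have hc : ∀ y, y * (j * j) = j * j * y := by
    intro y
    have h1 : i * (j * j) = j * j * i := by
      rw [mul_assoc j j i, hij, mul_neg, ← mul_assoc j i j, hij, neg_mul, neg_neg, mul_assoc]
    obtain ⟨x, y, z, w, rfl⟩ := exists_coeffs_of_anticommute hD hj hi0 hij y
    simp only [add_mul, mul_add, smul_mul_assoc, mul_smul_comm, Algebra.commutes, h1,
      mul_assoc]
    rw [← mul_assoc j j (i * j), ← mul_assoc (j * j) i j, ← h1]
    simp only [mul_assoc]
  obtain ⟨b, hb⟩ := mem_range_algebraMap_of_forall_commute hc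
  refine ⟨b, ?_, hb⟩
  rintro rfl
  simp [hj] at hb

/-- A noncentral element with a scalar square is part of a quaternion basis. -/
theorem exists_basis_of_sq [Algebra.IsCentral ℚ D] (hD : Module.finrank ℚ D = 4)
    {i : D} {a : ℚ} (hi : i * i = algebraMap ℚ D a) (hi' : ∀ r : ℚ, i ≠ algebraMap ℚ D r) :
    a ≠ 0 ∧ ∃ b : ℚ, b ≠ 0 ∧ Nonempty (Basis D a 0 b) := by
  have ha : a ≠ 0 := by
    rintro rfl
    apply hi' 0
    simpa using hi
  refine ⟨ha, ?_⟩
  have : ∃ y, y * i ≠ i * y := by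
    by_contra! h
    obtain ⟨r, hr⟩ := mem_range_algebraMap_of_forall_commute h
    exact hi' r hr
  obtain ⟨y, hy⟩ := this
  -- A commutator with `i` anticommutes with `i`, because `i * i` is central.
  have hij : (i * y - y * i) * i = -(i * (i * y - y * i)) := by
    rw [sub_mul, mul_sub, ← mul_assoc i i y, hi, mul_assoc y i i, hi, ← Algebra.commutes]
    simp only [mul_assoc]; abel
  obtain ⟨b, hb, hb'⟩ := exists_basis_of_anticommute hD hi ha (sub_ne_zero.2 (Ne.symm hy)) hij
  exact ⟨b, hb, ⟨quaternionBasis hi hb' hij⟩⟩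

/-- The field `ℚ(x)` has degree dividing 4. Degree 4 would make `D` commutative, hence equal to its
centre, so the degree is at most two and `1, x, x²` are dependent. -/
theorem exists_quadratic_relation [Algebra.IsCentral ℚ D] (hD : Module.finrank ℚ D = 4) (x : D) :
    ∃ s t : ℚ, x * x = s • x + algebraMap ℚ D t := by
  have : FiniteDimensional ℚ D := Module.finite_of_finrank_eq_succ hD
  let K := Algebra.adjoin ℚ {x}
  have : IsMulCommutative K := Algebra.isMulCommutative_adjoin ℚ (by simp)
  let _ : Field K := fieldOfFiniteDimensional ℚ K
  have hdvd : Module.finrank ℚ K * Module.finrank K D = 4 := by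
    rw [← hD]
    exact Module.finrank_mul_finrank ℚ K D
  have hne : Module.finrank ℚ K ≠ 4 := by
    intro h
    have htop : Subalgebra.toSubmodule K = ⊤ :=
      Submodule.eq_top_of_finrank_eq (by rw [hD]; exact h)
    have hmem : ∀ y, y ∈ K := fun y ↦ by
      rw [← Subalgebra.mem_toSubmodule, htop]; trivial
    have hcomm : ∀ y z : D, z * y = y * z := fun y z ↦
      congrArg Subtype.val (mul_comm (⟨z, hmem z⟩ : K) ⟨y, hmem y⟩)
    have : Module.finrank ℚ D ≤ 1 := by
      refine finrank_le_one (1 : D) fun w ↦ ?_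
      obtain ⟨a, rfl⟩ := mem_range_algebraMap_of_forall_commute (hcomm w)
      exact ⟨a, (Algebra.algebraMap_eq_smul_one a).symm⟩
    omega
  have hle : Module.finrank ℚ K ≤ 2 := by
    have h1 : Module.finrank ℚ K ∣ 4 := ⟨_, hdvd.symm⟩
    have h2 := Nat.le_of_dvd (by norm_num) h1
    interval_cases Module.finrank ℚ K <;> omega
  have hx : x ∈ K := Algebra.self_mem_adjoin_singleton ℚ x
  let f : (Fin 3 → ℚ) →ₗ[ℚ] K := Fintype.linearCombination ℚ ![1, ⟨x, hx⟩, ⟨x, hx⟩ * ⟨x, hx⟩]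
  have hker : LinearMap.ker f ≠ ⊥ := LinearMap.ker_ne_bot_of_finrank_lt (by
    rw [Module.finrank_fin_fun]
    omega)
  obtain ⟨v, hv, hv0⟩ := (Submodule.ne_bot_iff _).1 hker
  have h : v 0 • (1 : D) + v 1 • x + v 2 • (x * x) = 0 := by
    have := congrArg Subtype.val (LinearMap.mem_ker.1 hv)
    simpa [f, Fintype.linearCombination_apply, Fin.sum_univ_three] using this
  by_cases h2 : v 2 = 0
  · rw [h2, zero_smul, add_zero] at h
    by_cases h1 : v 1 = 0
    · rw [h1, zero_smul, add_zero, smul_eq_zero] at h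
      exact absurd (funext fun k ↦ by fin_cases k <;> simp_all) hv0
    · have hx : x = (-v 0 / v 1) • (1 : D) := by
        have : x = (v 1)⁻¹ • (v 0 • (1 : D) + v 1 • x) + (-v 0 / v 1) • (1 : D) := by
          rw [smul_add, smul_smul, smul_smul, inv_mul_cancel₀ h1]
          module
        rw [h, smul_zero, zero_add] at this
        exact this
      refine ⟨-v 0 / v 1, 0, ?_⟩
      nth_rw 1 [hx]
      simp
  · refine ⟨-v 1 / v 2, -v 0 / v 2, ?_⟩
    have : x * x = (v 2)⁻¹ • (v 0 • (1 : D) + v 1 • x + v 2 • (x * x)) +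
        ((-v 1 / v 2) • x + (-v 0 / v 2) • (1 : D)) := by
      rw [smul_add, smul_add, smul_smul, smul_smul, smul_smul, inv_mul_cancel₀ h2]
      module
    rw [h, smul_zero, zero_add] at this
    rw [Algebra.algebraMap_eq_smul_one]
    exact this

/-- A four-dimensional central division algebra is a quaternion algebra. -/
theorem exists_quaternion_basis [Algebra.IsCentral ℚ D] (hD : Module.finrank ℚ D = 4) :
    ∃ a b : ℚ, a ≠ 0 ∧ b ≠ 0 ∧ Nonempty (Basis D a 0 b) := by
  have : ∃ x : D, ∀ r : ℚ, x ≠ algebraMap ℚ D r := by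
    by_contra! h
    have : Module.finrank ℚ D ≤ 1 := by
      refine finrank_le_one (1 : D) fun w ↦ ?_
      obtain ⟨a, rfl⟩ := h w
      exact ⟨a, (Algebra.algebraMap_eq_smul_one a).symm⟩
    omega
  obtain ⟨x, hx⟩ := this
  obtain ⟨s, t, hst⟩ := exists_quadratic_relation hD x
  -- Completing the square produces a noncentral element with rational square.
  have hi : (x - algebraMap ℚ D (s / 2)) * (x - algebraMap ℚ D (s / 2)) =
      algebraMap ℚ D (t + s ^ 2 / 4) := by
    rw [sub_mul, mul_sub, mul_sub, ← Algebra.commutes (s / 2) x, hst]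
    simp only [Algebra.algebraMap_eq_smul_one, smul_mul_assoc, one_mul, smul_smul]
    module
  obtain ⟨ha, b, hb, hq⟩ := exists_basis_of_sq hD hi fun r hr ↦ hx (r + s / 2) (by
    rw [map_add, ← hr, sub_add_cancel])
  exact ⟨_, b, ha, hb, hq⟩

/-- The norm form `x² - a y² - b z² + a b w²` has no nontrivial zero over `K`. -/
def IsNormFormAnisotropic (K : Type*) [Field K] [Algebra ℚ K] (a b : ℚ) : Prop :=
  ∀ x y z w : K, x ^ 2 - algebraMap ℚ K a * y ^ 2 - algebraMap ℚ K b * z ^ 2 +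
    algebraMap ℚ K a * algebraMap ℚ K b * w ^ 2 = 0 → x = 0 ∧ y = 0 ∧ z = 0 ∧ w = 0

/-- The form is the scalar `q * star q`. A nonzero value makes `q` invertible since `q` and `star q`
commute; a nontrivial zero gives a zero divisor. -/
theorem forall_isUnit_quaternionAlgebra_iff {K : Type*} [Field K] {a b : K} :
    (∀ q : ℍ[K,a,b], q ≠ 0 → IsUnit q) ↔
      ∀ x y z w : K, x ^ 2 - a * y ^ 2 - b * z ^ 2 + a * b * w ^ 2 = 0 →
        x = 0 ∧ y = 0 ∧ z = 0 ∧ w = 0 := by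
  have key : ∀ q : ℍ[K,a,b], q * star q = algebraMap K _ (q.re ^ 2 - a * q.imI ^ 2 -
      b * q.imJ ^ 2 + a * b * q.imK ^ 2) := by
    intro q
    ext <;> simp [QuaternionAlgebra.algebraMap_eq] <;> ring
  constructor
  · intro h x y z w hN
    by_contra hne
    have hq : (⟨x, y, z, w⟩ : ℍ[K,a,b]) ≠ 0 := by
      intro h0
      rw [QuaternionAlgebra.ext_iff] at h0
      exact hne h0
    have h1 := key ⟨x, y, z, w⟩
    rw [hN, map_zero] at h1
    exact hq (star_eq_zero.1 (((h _ hq).mul_right_eq_zero).1 h1))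
  · intro h q hq
    have hN : q.re ^ 2 - a * q.imI ^ 2 - b * q.imJ ^ 2 + a * b * q.imK ^ 2 ≠ 0 := by
      intro hN
      obtain ⟨h0, h1, h2, h3⟩ := h _ _ _ _ hN
      exact hq (by ext <;> assumption)
    have h1 := key q
    have hcomm : Commute q (star q) := (star_comm_self' q).symm
    have hu : IsUnit (q * star q) := by
      rw [h1]
      exact (isUnit_iff_ne_zero.2 hN).map _
    exact (hcomm.isUnit_mul_iff.1 hu).1

/-- The base change of a division algebra with quaternion basis `(a, b)` is a division algebra
if and only if its norm form is anisotropic. -/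
theorem QuaternionAlgebra.Basis.isDivisionOver_iff (hD : Module.finrank ℚ D = 4) {a b : ℚ}
    (q : Basis D a 0 b) (ha : a ≠ 0) (hb : b ≠ 0) (K : Type*) [Field K] [Algebra ℚ K] :
    IsDivisionOver K D ↔ IsNormFormAnisotropic K a b := by
  have : FiniteDimensional ℚ D := Module.finite_of_finrank_eq_succ hD
  let r : Basis (K ⊗[ℚ] D) (algebraMap ℚ K a) 0 (algebraMap ℚ K b) :=
    { i := 1 ⊗ₜ q.i
      j := 1 ⊗ₜ q.j
      k := 1 ⊗ₜ q.k
      i_mul_i := by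
        rw [algebraMap_smul]
        simp [Algebra.TensorProduct.one_def, TensorProduct.tmul_smul]
      j_mul_j := by
        rw [algebraMap_smul]
        simp [Algebra.TensorProduct.one_def, TensorProduct.tmul_smul]
      i_mul_j := by simp
      j_mul_i := by simp [TensorProduct.tmul_neg] }
  have hsurj : Function.Surjective r.liftHom := by
    intro x
    induction x using TensorProduct.induction_on with
    | zero => exact ⟨0, map_zero _⟩
    | add x y hx hy =>
      obtain ⟨x, rfl⟩ := hx
      obtain ⟨y, rfl⟩ := hy
      exact ⟨x + y, map_add _ _ _⟩
    | tmul c d =>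
      obtain ⟨v, rfl⟩ := (q.liftHom_bijective hD ha hb).2 d
      refine ⟨c • ⟨algebraMap ℚ K v.re, algebraMap ℚ K v.imI, algebraMap ℚ K v.imJ,
        algebraMap ℚ K v.imK⟩, ?_⟩
      have h1 : c ⊗ₜ[ℚ] q.liftHom v = c • ((1 : K) ⊗ₜ[ℚ] q.liftHom v) := by
        rw [TensorProduct.smul_tmul', smul_eq_mul, mul_one]
      rw [map_smul, h1]
      congr 1
      rw [Basis.liftHom_apply, Basis.liftHom_apply, Basis.lift, Basis.lift]
      simp only [algebraMap_smul, TensorProduct.tmul_add, TensorProduct.tmul_smul,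
        Algebra.algebraMap_eq_smul_one (R := K), Algebra.algebraMap_eq_smul_one (R := ℚ) (A := D),
        Algebra.TensorProduct.one_def, r]
  have hbij : Function.Bijective r.liftHom := by
    refine ⟨?_, hsurj⟩
    exact (LinearMap.injective_iff_surjective_of_finrank_eq_finrank
      (f := r.liftHom.toLinearMap) (by
        rw [QuaternionAlgebra.finrank_eq_four, Module.finrank_baseChange, hD])).2 hsurj
  let e := AlgEquiv.ofBijective r.liftHom hbij
  rw [IsNormFormAnisotropic, ← forall_isUnit_quaternionAlgebra_iff]
  constructor
  · intro h x hx
    exact (isUnit_map_iff e x).1 (h (e x) (by simpa using hx))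
  · intro h x hx
    exact (isUnit_map_iff e.symm x).1 (h (e.symm x) (by simpa using hx))

end Structure

/-! ### Anisotropy of norm forms over `ℚ_p` and `ℝ`. -/

section Local

variable {p : ℕ} [Fact p.Prime]

theorem PadicInt.toZMod_eq_zero_iff {x : ℤ_[p]} : PadicInt.toZMod x = 0 ↔ ‖x‖ < 1 := by
  rw [← RingHom.mem_ker, PadicInt.ker_toZMod, IsLocalRing.mem_maximalIdeal, PadicInt.mem_nonunits]

theorem eq_zero_of_sq_add_mul_sq_eq_zero {F : Type*} [Field F] {c x z : F} (hc : ¬IsSquare (-c))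
    (h : x ^ 2 + c * z ^ 2 = 0) : x = 0 ∧ z = 0 := by
  have hz : z = 0 := by
    by_contra hz
    refine hc ⟨x / z, ?_⟩
    field_simp
    linear_combination -h
  subst hz
  simpa using h

/-- Modulo `p` the form `s² + c t²` is anisotropic, so it takes unit values on primitive vectors. -/
theorem PadicInt.norm_sq_add_mul_sq_eq_one {c : ℤ} (hc : ¬IsSquare (-(c : ZMod p))) {s t : ℤ_[p]}
    (h : ‖s‖ = 1 ∨ ‖t‖ = 1) : ‖s ^ 2 + c * t ^ 2‖ = 1 := by
  by_contra hne
  have hlt : ‖s ^ 2 + c * t ^ 2‖ < 1 := lt_of_le_of_ne (PadicInt.norm_le_one _) hne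
  rw [← PadicInt.toZMod_eq_zero_iff] at hlt
  simp only [map_add, map_mul, map_pow, map_intCast] at hlt
  obtain ⟨h1, h2⟩ := eq_zero_of_sq_add_mul_sq_eq_zero hc hlt
  rw [PadicInt.toZMod_eq_zero_iff] at h1 h2
  rcases h with h | h <;> linarith

/-- If `-c` is not a square modulo `p`, the values of `x² + c z²` have even valuation. -/
theorem Padic.exists_norm_sq_add_mul_sq {c : ℤ} (hc : ¬IsSquare (-(c : ZMod p))) {x z : ℚ_[p]}
    (h : ¬(x = 0 ∧ z = 0)) : ∃ M : ℚ_[p], M ≠ 0 ∧ ‖x ^ 2 + c * z ^ 2‖ = ‖M‖ ^ 2 := by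
  rcases le_total ‖z‖ ‖x‖ with hle | hle
  · have hx : x ≠ 0 := by
      rintro rfl
      simp_all
    refine ⟨x, hx, ?_⟩
    obtain ⟨t, ht⟩ : ∃ t : ℤ_[p], (t : ℚ_[p]) = z / x := ⟨⟨z / x, by
      rw [norm_div]; exact div_le_one_of_le₀ hle (norm_nonneg _)⟩, rfl⟩
    have h1 := PadicInt.norm_sq_add_mul_sq_eq_one hc (s := 1) (t := t) (by simp)
    rw [PadicInt.norm_def] at h1
    push_cast at h1
    rw [ht] at h1
    have h2 : x ^ 2 + c * z ^ 2 = x ^ 2 * (1 ^ 2 + c * (z / x) ^ 2) := by field_simp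
    rw [h2, norm_mul, h1, mul_one, norm_pow]
  · have hz : z ≠ 0 := by
      rintro rfl
      simp_all
    refine ⟨z, hz, ?_⟩
    obtain ⟨t, ht⟩ : ∃ t : ℤ_[p], (t : ℚ_[p]) = x / z := ⟨⟨x / z, by
      rw [norm_div]; exact div_le_one_of_le₀ hle (norm_nonneg _)⟩, rfl⟩
    have h1 := PadicInt.norm_sq_add_mul_sq_eq_one hc (s := t) (t := 1) (by simp)
    rw [PadicInt.norm_def] at h1
    push_cast at h1
    rw [ht] at h1
    have h2 : x ^ 2 + c * z ^ 2 = z ^ 2 * ((x / z) ^ 2 + c * 1 ^ 2) := by field_simp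
    rw [h2, norm_mul, h1, mul_one, norm_pow]

/-- `(-m, -c)` is ramified at `p` if `p` divides `m` exactly and `-c` is not a square mod `p`. -/
theorem isNormFormAnisotropic_padic {c m : ℤ} (hc : ¬IsSquare (-(c : ZMod p)))
    (hm : (p : ℤ) ∣ m) (hm' : ¬(p : ℤ) ^ 2 ∣ m) : IsNormFormAnisotropic ℚ_[p] (-m) (-c) := by
  have hp : 1 < (p : ℝ) := by exact_mod_cast (Fact.out : p.Prime).one_lt
  obtain ⟨e, rfl⟩ := hm
  have he : ‖(e : ℚ_[p])‖ = 1 := by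
    refine le_antisymm (Padic.norm_int_le_one e) (not_lt.1 fun h ↦ hm' ?_)
    rw [Padic.norm_intCast_lt_one_iff] at h
    rw [sq]
    exact mul_dvd_mul_left _ h
  intro x y z w h
  -- Both binary values have even valuation when nonzero, while the factor `m = p e` has valuation
  -- one: a parity contradiction.
  have h1 : x ^ 2 + c * z ^ 2 = -((p : ℚ_[p]) * e * (y ^ 2 + c * w ^ 2)) := by
    simp only [eq_ratCast] at h
    push_cast at h
    linear_combination h
  have h2 : ‖x ^ 2 + c * z ^ 2‖ = (p : ℝ)⁻¹ * ‖y ^ 2 + c * w ^ 2‖ := by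
    rw [h1, norm_neg, norm_mul, norm_mul, he, Padic.norm_p, mul_one]
  by_cases hxz : x = 0 ∧ z = 0
  · by_cases hyw : y = 0 ∧ w = 0
    · exact ⟨hxz.1, hyw.1, hxz.2, hyw.2⟩
    · obtain ⟨M, hM, hM'⟩ := Padic.exists_norm_sq_add_mul_sq hc hyw
      rw [hM', hxz.1, hxz.2] at h2
      have : (p : ℝ)⁻¹ * ‖M‖ ^ 2 ≠ 0 := by
        have := norm_ne_zero_iff.2 hM
        positivity
      simp [eq_comm, this] at h2
  · obtain ⟨M, hM, hM'⟩ := Padic.exists_norm_sq_add_mul_sq hc hxz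
    rw [hM'] at h2
    by_cases hyw : y = 0 ∧ w = 0
    · rw [hyw.1, hyw.2] at h2
      simp [hM] at h2
    · obtain ⟨N, hN, hN'⟩ := Padic.exists_norm_sq_add_mul_sq hc hyw
      rw [hN', Padic.norm_eq_zpow_neg_valuation hM, Padic.norm_eq_zpow_neg_valuation hN,
        ← zpow_neg_one, ← zpow_natCast, ← zpow_natCast, ← zpow_mul, ← zpow_mul,
        ← zpow_add₀ (by positivity)] at h2
      have := zpow_right_injective₀ (by positivity) hp.ne' h2
      push_cast at this
      omega

theorem PadicInt.exists_sq_eq {s a : ℤ_[p]} (h : ‖a ^ 2 - s‖ < ‖2 * a‖ ^ 2) :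
    ∃ z : ℤ_[p], z ^ 2 = s := by
  have := hensels_lemma (p := p) (F := (Polynomial.X ^ 2 - Polynomial.C s)) (a := a)
    (by simpa [one_add_one_eq_two] using h)
  obtain ⟨z, hz, -⟩ := this
  exact ⟨z, by simpa [sub_eq_zero] using hz⟩

/-- Every residue is a sum of two squares modulo `p`; as `n` is a unit one summand is nonzero, and
that one is adjusted by Hensel's lemma. -/
theorem Padic.exists_sq_add_sq_eq (hp : p ≠ 2) {n : ℤ} (hn : ¬(p : ℤ) ∣ n) :
    ∃ x y : ℚ_[p], x ^ 2 + y ^ 2 = n := by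
  obtain ⟨a, b, hab⟩ := ZMod.sq_add_sq p (n : ZMod p)
  have hn0 : (n : ZMod p) ≠ 0 := by rwa [Ne, ZMod.intCast_zmod_eq_zero_iff_dvd]
  have key : ∀ a b : ZMod p, a ^ 2 + b ^ 2 = n → a ≠ 0 → ∃ x y : ℚ_[p], x ^ 2 + y ^ 2 = n := by
    intro a b hab ha
    obtain ⟨a, rfl⟩ := ZMod.ringHom_surjective (PadicInt.toZMod (p := p)) a
    obtain ⟨b, rfl⟩ := ZMod.ringHom_surjective (PadicInt.toZMod (p := p)) b
    have h1 : ‖a ^ 2 - (n - b ^ 2)‖ < 1 := by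
      rw [← PadicInt.toZMod_eq_zero_iff]
      simp only [map_sub, map_pow, map_intCast]
      linear_combination hab
    have h2 : ‖(2 * a : ℤ_[p])‖ = 1 := by
      by_contra hne
      have := lt_of_le_of_ne (PadicInt.norm_le_one _) hne
      rw [← PadicInt.toZMod_eq_zero_iff, map_mul, mul_eq_zero] at this
      have h20 : (2 : ZMod p) ≠ 0 := by
        have : ((2 : ℕ) : ZMod p) ≠ 0 := by
          rw [Ne, ZMod.natCast_eq_zero_iff, Nat.prime_dvd_prime_iff_eq Fact.out Nat.prime_two]
          exact hp
        exact_mod_cast this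
      rcases this with h | h
      · exact h20 (by simpa only [map_ofNat] using h)
      · exact ha h
    obtain ⟨z, hz⟩ := PadicInt.exists_sq_eq (s := (n : ℤ_[p]) - b ^ 2) (a := a)
      (by rw [h2, one_pow]; exact h1)
    refine ⟨z, b, ?_⟩
    have := congrArg (fun t : ℤ_[p] ↦ (t : ℚ_[p])) hz
    push_cast at this
    linear_combination this
  by_cases ha : a = 0
  · refine key b a (by rw [add_comm]; exact hab) ?_
    rintro rfl
    rw [ha] at hab
    exact hn0 (by simpa using hab.symm)
  · exact key a b hab ha

/-- Dividing a zero by its coordinate of largest norm would give `1 + y² + z² + w² = 0` modulo 8,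
which has no solution. -/
theorem isNormFormAnisotropic_two : IsNormFormAnisotropic ℚ_[2] (-1) (-1) := by
  have hmod : ∀ y z w : ZMod (2 ^ 3), 1 + y ^ 2 + z ^ 2 + w ^ 2 ≠ 0 := by decide
  have key : ∀ x y z w : ℚ_[2], x ^ 2 + y ^ 2 + z ^ 2 + w ^ 2 = 0 → ‖y‖ ≤ ‖x‖ → ‖z‖ ≤ ‖x‖ →
      ‖w‖ ≤ ‖x‖ → x = 0 := by
    intro x y z w h hy hz hw
    by_contra hx
    have hd : ∀ y : ℚ_[2], ‖y‖ ≤ ‖x‖ → ∃ t : ℤ_[2], (t : ℚ_[2]) = y / x := fun y hy ↦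
      ⟨⟨y / x, by rw [norm_div]; exact div_le_one_of_le₀ hy (norm_nonneg _)⟩, rfl⟩
    obtain ⟨y', hy'⟩ := hd y hy
    obtain ⟨z', hz'⟩ := hd z hz
    obtain ⟨w', hw'⟩ := hd w hw
    have h1 : 1 + y' ^ 2 + z' ^ 2 + w' ^ 2 = 0 := by
      apply Subtype.ext
      push_cast
      rw [hy', hz', hw']
      field_simp
      linear_combination h
    have h2 := congrArg (PadicInt.toZModPow 3) h1
    simp only [map_add, map_pow, map_one, map_zero] at h2
    exact hmod _ _ _ h2
  intro x y z w h
  have h' : x ^ 2 + y ^ 2 + z ^ 2 + w ^ 2 = 0 := by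
    simp only [eq_ratCast] at h
    push_cast at h
    linear_combination h
  suffices ∃ M : ℚ_[2], M = 0 ∧ ‖x‖ ≤ ‖M‖ ∧ ‖y‖ ≤ ‖M‖ ∧ ‖z‖ ≤ ‖M‖ ∧ ‖w‖ ≤ ‖M‖ by
    obtain ⟨M, rfl, h0, h1, h2, h3⟩ := this
    rw [norm_zero, norm_le_zero_iff] at h0 h1 h2 h3
    exact ⟨h0, h1, h2, h3⟩
  rcases le_total ‖x‖ ‖y‖ with hxy | hxy <;> rcases le_total ‖z‖ ‖w‖ with hzw | hzw
  · rcases le_total ‖y‖ ‖w‖ with hyw | hyw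
    · exact ⟨w, key w x y z (by linear_combination h') (hxy.trans hyw) hyw hzw, hxy.trans hyw, hyw,
        hzw, le_rfl⟩
    · exact ⟨y, key y x z w (by linear_combination h') hxy (hzw.trans hyw) hyw, hxy, le_rfl,
        hzw.trans hyw, hyw⟩
  · rcases le_total ‖y‖ ‖z‖ with hyw | hyw
    · exact ⟨z, key z x y w (by linear_combination h') (hxy.trans hyw) hyw hzw, hxy.trans hyw, hyw,
        le_rfl, hzw⟩
    · exact ⟨y, key y x z w (by linear_combination h') hxy hyw (hzw.trans hyw), hxy, le_rfl,
        hyw, hzw.trans hyw⟩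
  · rcases le_total ‖x‖ ‖w‖ with hyw | hyw
    · exact ⟨w, key w x y z (by linear_combination h') hyw (hxy.trans hyw) hzw, hyw, hxy.trans hyw,
        hzw, le_rfl⟩
    · exact ⟨x, key x y z w (by linear_combination h') hxy (hzw.trans hyw) hyw, le_rfl, hxy,
        hzw.trans hyw, hyw⟩
  · rcases le_total ‖x‖ ‖z‖ with hyw | hyw
    · exact ⟨z, key z x y w (by linear_combination h') hyw (hxy.trans hyw) hzw, hyw, hxy.trans hyw,
        le_rfl, hzw⟩
    · exact ⟨x, key x y z w (by linear_combination h') hxy hyw (hzw.trans hyw), le_rfl, hxy,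
        hyw, hzw.trans hyw⟩

/-- `(-1, -c)` is split at an odd prime not dividing `c`. -/
theorem not_isNormFormAnisotropic_padic (hp : p ≠ 2) {c : ℤ} (hc : ¬(p : ℤ) ∣ c) :
    ¬IsNormFormAnisotropic ℚ_[p] (-1) (-c) := by
  intro h
  obtain ⟨x, y, hxy⟩ := Padic.exists_sq_add_sq_eq hp (n := -c) (by rwa [dvd_neg])
  have := h x y 1 0 (by
    simp only [eq_ratCast]
    push_cast at hxy ⊢
    linear_combination hxy)
  simp at this

/-- Since `-15` is 1 modulo 16, it is a 2-adic square, and `-15 + 3 · 1² + 3 · 2² = 0`. -/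
theorem not_isNormFormAnisotropic_two : ¬IsNormFormAnisotropic ℚ_[2] (-1) (-3) := by
  intro h
  obtain ⟨x, hx⟩ := PadicInt.exists_sq_eq (p := 2) (s := (-15 : ℤ)) (a := 1) (by
    have h1 : ((1 : ℤ_[2]) ^ 2 - ((-15 : ℤ) : ℤ_[2])) = (2 : ℕ) ^ 4 := by push_cast; norm_num
    have h2 : (2 * 1 : ℤ_[2]) = (2 : ℕ) := by push_cast; norm_num
    rw [h1, h2, norm_pow, PadicInt.norm_p]
    norm_num)
  have hx' : (x : ℚ_[2]) ^ 2 = ((-15 : ℤ) : ℚ_[2]) := by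
    rw [← PadicInt.coe_intCast, ← hx, PadicInt.coe_pow]
  have := h x 0 1 2 (by
    simp only [eq_ratCast]
    rw [hx']
    push_cast
    norm_num)
  simp at this

theorem isNormFormAnisotropic_real_iff {a b : ℚ} :
    IsNormFormAnisotropic ℝ a b ↔ a < 0 ∧ b < 0 := by
  constructor
  · intro h
    constructor
    · by_contra! hlt
      have := h (√(a : ℝ)) 1 0 0 (by
        rw [Real.sq_sqrt (by exact_mod_cast hlt)]
        simp)
      simp at this
    · by_contra! hlt
      have := h (√(b : ℝ)) 0 1 0 (by
        rw [Real.sq_sqrt (by exact_mod_cast hlt)]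
        simp)
      simp at this
  · rintro ⟨ha, hb⟩ x y z w h
    simp only [eq_ratCast] at h
    have ha' : (a : ℝ) < 0 := by exact_mod_cast ha
    have hb' : (b : ℝ) < 0 := by exact_mod_cast hb
    have hab := mul_pos_of_neg_of_neg ha' hb'
    have h1 := mul_nonneg (neg_pos.2 ha').le (sq_nonneg y)
    have h2 := mul_nonneg (neg_pos.2 hb').le (sq_nonneg z)
    have h3 := mul_nonneg hab.le (sq_nonneg w)
    have h0 := sq_nonneg x
    refine ⟨?_, ?_, ?_, ?_⟩
    · have : x ^ 2 = 0 := by linarith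
      simpa using this
    · have : -(a : ℝ) * y ^ 2 = 0 := by linarith
      simpa [ha'.ne] using this
    · have : -(b : ℝ) * z ^ 2 = 0 := by linarith
      simpa [hb'.ne] using this
    · have : (a : ℝ) * b * w ^ 2 = 0 := by linarith
      simpa [ha'.ne, hb'.ne] using this

end Local

/-! ### Gauss and Hermite reduction of binary and ternary forms. -/

section Reduction

theorem Int.exists_two_mul_add_mul_le {a : ℤ} (ha : 0 < a) (b : ℤ) :
    ∃ k, -a ≤ 2 * (b + k * a) ∧ 2 * (b + k * a) ≤ a := by
  refine ⟨-((2 * b + a) / (2 * a)), ?_⟩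
  have h1 := Int.emod_nonneg (2 * b + a) (b := 2 * a) (by omega)
  have h2 := Int.emod_lt_of_pos (2 * b + a) (b := 2 * a) (by omega)
  have h3 := Int.emod_add_mul_ediv (2 * b + a) (2 * a)
  constructor <;> linarith

/-- A positive definite integral binary form of determinant `d` primitively represents some
`n` with `3 n² ≤ 4 d`. -/
theorem exists_reduced_binary (a b c : ℤ) (ha : 0 < a) (hd : 0 < a * c - b ^ 2) :
    ∃ p q r s : ℤ, p * s - q * r = 1 ∧ 0 < a * p ^ 2 + 2 * b * p * r + c * r ^ 2 ∧
      3 * (a * p ^ 2 + 2 * b * p * r + c * r ^ 2) ^ 2 ≤ 4 * (a * c - b ^ 2) := by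
  induction hn : a.toNat using Nat.strong_induction_on generalizing a b c with
  | _ n ih =>
    obtain ⟨k, hk1, hk2⟩ := Int.exists_two_mul_add_mul_le ha b
    obtain ⟨b', hb'⟩ : ∃ b', b' = b + k * a := ⟨_, rfl⟩
    obtain ⟨c', hc'⟩ : ∃ c', c' = c + 2 * k * b + k ^ 2 * a := ⟨_, rfl⟩
    rw [← hb'] at hk1 hk2
    have hdet : a * c' - b' ^ 2 = a * c - b ^ 2 := by rw [hb', hc']; ring
    have hsq : 4 * b' ^ 2 ≤ a ^ 2 := by nlinarith
    -- With `2|b'| ≤ a ≤ c'` the determinant is at least `3a²/4`. If instead `c' < a`, the basis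
    -- vectors are swapped and the leading coefficient drops.
    rcases le_or_gt a c' with hle | hlt
    · refine ⟨1, 0, 0, 1, by norm_num, by simpa using ha, ?_⟩
      have : a * a ≤ a * c' := by gcongr
      nlinarith
    · have hc0 : 0 < c' := by
        by_contra! h
        nlinarith [mul_nonneg ha.le (neg_nonneg.2 h), sq_nonneg b']
      obtain ⟨p, q, r, s, h1, h2, h3⟩ := ih c'.toNat (by omega) c' (-b') a hc0
        (by linarith) rfl
      refine ⟨-r + k * p, -s + k * q, p, q, by linear_combination h1, ?_⟩
      have hval : a * (-r + k * p) ^ 2 + 2 * b * (-r + k * p) * p + c * p ^ 2 =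
          c' * p ^ 2 + 2 * -b' * p * r + a * r ^ 2 := by
        rw [hb', hc']; ring
      rw [hval]
      exact ⟨h2, h3.trans (by linarith)⟩

set_option maxHeartbeats 400000 in
/-- Hermite's bound: a positive definite integral ternary form of determinant `d` represents some
`n > 0` with `27 n³ ≤ 64 d`. -/
theorem exists_reduced_ternary (a b c e f g : ℤ) (ha : 0 < a) (hab : 0 < a * b - g ^ 2)
    (hd : 0 < a * b * c + 2 * e * f * g - a * e ^ 2 - b * f ^ 2 - c * g ^ 2) :
    ∃ x y z n : ℤ,
      n = a * x ^ 2 + b * y ^ 2 + c * z ^ 2 + 2 * e * y * z + 2 * f * x * z + 2 * g * x * y ∧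
      0 < n ∧
      27 * n ^ 3 ≤ 64 * (a * b * c + 2 * e * f * g - a * e ^ 2 - b * f ^ 2 - c * g ^ 2) := by
  induction hn : a.toNat using Nat.strong_induction_on generalizing a b c e f g with
  | _ n ih =>
    obtain ⟨d, hdd⟩ : ∃ d, d = a * b * c + 2 * e * f * g - a * e ^ 2 - b * f ^ 2 - c * g ^ 2 :=
      ⟨_, rfl⟩
    rw [← hdd] at hd ⊢
    -- Multiplying by `a` and completing the square in `x` leaves this binary form of determinant `a
    -- d`. Reducing it chooses the second basis vector so that the minor `m` has `3m² ≤ 4ad`.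
    have hbin : (a * b - g ^ 2) * (a * c - f ^ 2) - (a * e - f * g) ^ 2 = a * d := by
      rw [hdd]; ring
    obtain ⟨P, Q, R, S, hdet, hn0, hn1⟩ := exists_reduced_binary (a * b - g ^ 2) (a * e - f * g)
      (a * c - f ^ 2) hab (by rw [hbin]; positivity)
    rw [hbin] at hn1
    obtain ⟨m, hm⟩ : ∃ m, m = (a * b - g ^ 2) * P ^ 2 + 2 * (a * e - f * g) * P * R +
      (a * c - f ^ 2) * R ^ 2 := ⟨_, rfl⟩
    rw [← hm] at hn0 hn1
    obtain ⟨k, hk1, hk2⟩ := Int.exists_two_mul_add_mul_le ha (g * P + f * R)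
    obtain ⟨g', hg'⟩ : ∃ g', g' = g * P + f * R + k * a := ⟨_, rfl⟩
    rw [← hg'] at hk1 hk2
    obtain ⟨b', hb'⟩ : ∃ b', b' = b * P ^ 2 + 2 * e * P * R + c * R ^ 2 +
      2 * k * (g * P + f * R) + k ^ 2 * a := ⟨_, rfl⟩
    obtain ⟨f', hf'⟩ : ∃ f', f' = g * Q + f * S := ⟨_, rfl⟩
    obtain ⟨e', he'⟩ : ∃ e', e' = b * P * Q + e * (P * S + Q * R) + c * R * S + k * f' := ⟨_, rfl⟩
    obtain ⟨c', hc'⟩ : ∃ c', c' = b * Q ^ 2 + 2 * e * Q * S + c * S ^ 2 := ⟨_, rfl⟩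
    have hm' : a * b' - g' ^ 2 = m := by rw [hm, hb', hg']; ring
    have hd' : b' * a * c' + 2 * f' * e' * g' - b' * f' ^ 2 - a * e' ^ 2 - c' * g' ^ 2 = d := by
      have : b' * a * c' + 2 * f' * e' * g' - b' * f' ^ 2 - a * e' ^ 2 - c' * g' ^ 2 =
          d * (P * S - Q * R) ^ 2 := by
        rw [hdd, hb', hc', he', hf', hg']; ring
      rw [this, hdet]; ring
    have hsq : 4 * g' ^ 2 ≤ a ^ 2 := by nlinarith
    -- If `a ≤ b'` then `3a² ≤ 4m`, which combines with `3m² ≤ 4ad` to Hermite's bound; otherwise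
    -- `b'` is a smaller leading coefficient.
    rcases le_or_gt a b' with hle | hlt
    · refine ⟨1, 0, 0, a, by ring, ha, ?_⟩
      have h1 : a * a ≤ a * b' := by gcongr
      have h2 : 3 * a ^ 2 ≤ 4 * m := by nlinarith
      have h3 : (3 * a ^ 2) ^ 2 ≤ (4 * m) ^ 2 := by gcongr
      have h4 : a * (27 * a ^ 3) ≤ a * (64 * d) :=
        calc a * (27 * a ^ 3) = 3 * (3 * a ^ 2) ^ 2 := by ring
          _ ≤ 3 * (4 * m) ^ 2 := by linarith
          _ = 16 * (3 * m ^ 2) := by ring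
          _ ≤ 16 * (4 * (a * d)) := by linarith
          _ = a * (64 * d) := by ring
      exact le_of_mul_le_mul_left h4 ha
    · have hb0 : 0 < b' := by
        by_contra! h
        nlinarith [mul_nonneg ha.le (neg_nonneg.2 h), sq_nonneg g']
      obtain ⟨x, y, z, v, h1, h2, h3⟩ := ih b'.toNat (by omega) b' a c' f' e' g' hb0
        (by linarith) (by linarith) rfl
      refine ⟨y + k * x, P * x + Q * z, R * x + S * z, v, ?_, h2, by linarith⟩
      rw [h1, hb', hc', he', hf', hg']
      ring

end Reduction

/-! ### Congruences, a Legendre-type theorem, and the form `x² + 3y²`. -/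

section Arithmetic

theorem Int.exists_dvd_sub_of_isCoprime {m n : ℤ} (h : IsCoprime m n) (a b : ℤ) :
    ∃ x, m ∣ x - a ∧ n ∣ x - b := by
  obtain ⟨s, t, hst⟩ := h
  exact ⟨a * (t * n) + b * (s * m), ⟨(b - a) * s, by linear_combination a * hst⟩,
    ⟨(a - b) * t, by linear_combination b * hst⟩⟩

/-- Square roots modulo the distinct prime divisors are glued by the Chinese remainder theorem. -/
theorem Int.exists_dvd_sq_sub_of_squarefree {n : ℕ} (hn : Squarefree n) {m : ℤ}
    (h : ∀ p : ℕ, p.Prime → p ∣ n → IsSquare (m : ZMod p)) : ∃ s : ℤ, (n : ℤ) ∣ s ^ 2 - m := by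
  induction n using induction_on_primes with
  | zero => simp at hn
  | one => exact ⟨0, by simp⟩
  | prime_mul p k hp ih =>
    obtain ⟨hcop, -, hk⟩ := Nat.squarefree_mul_iff.1 hn
    obtain ⟨s, hs⟩ := ih hk fun q hq hqk ↦ h q hq (hqk.mul_left p)
    obtain ⟨t, ht⟩ := h p hp (dvd_mul_right p k)
    obtain ⟨t, rfl⟩ := ZMod.intCast_surjective t
    have ht' : (p : ℤ) ∣ t ^ 2 - m := by
      rw [← ZMod.intCast_zmod_eq_zero_iff_dvd]
      push_cast
      rw [ht]; ring
    have hcop' : IsCoprime (p : ℤ) k := Nat.isCoprime_iff_coprime.2 hcop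
    obtain ⟨x, hx1, hx2⟩ := Int.exists_dvd_sub_of_isCoprime hcop' t s
    refine ⟨x, ?_⟩
    push_cast
    apply hcop'.mul_dvd
    · have : x ^ 2 - m = (x - t) * (x + t) + (t ^ 2 - m) := by ring
      rw [this]
      exact dvd_add (hx1.mul_right _) ht'
    · have : x ^ 2 - m = (x - s) * (x + s) + (s ^ 2 - m) := by ring
      rw [this]
      exact dvd_add (hx2.mul_right _) hs

theorem Int.exists_dvd_mul_sq_add {n : ℕ} (hn : Squarefree n) {v w : ℤ} (hw : IsCoprime (n : ℤ) w)
    (h : ∀ p : ℕ, p.Prime → p ∣ n → IsSquare (-(v * w : ℤ) : ZMod p)) :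
    ∃ α : ℤ, (n : ℤ) ∣ w * α ^ 2 + v := by
  obtain ⟨s, hs⟩ := Int.exists_dvd_sq_sub_of_squarefree hn (m := -(v * w)) (by
    intro p hp hpn
    push_cast
    have := h p hp hpn
    push_cast at this
    exact this)
  obtain ⟨x, y, hxy⟩ := hw
  refine ⟨s * y, ?_⟩
  refine IsCoprime.dvd_of_dvd_mul_left (y := w) ⟨x, y, hxy⟩ ?_
  obtain ⟨t, ht⟩ := hs
  refine ⟨t - s ^ 2 * x * (1 + y * w), ?_⟩
  linear_combination ht + s ^ 2 * (1 + y * w) * hxy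

/-- Legendre-type solution of a ternary equation by reduction of an integral lattice. -/
theorem exists_ternary_solution {u v w e : ℤ} (hu : 0 < u) (hv : 0 < v) (hw : 0 < w) (he : 0 < e)
    (he3 : e ≤ 3) (huv : IsCoprime u v) (huw : IsCoprime u w) (hvw : IsCoprime v w) {α β γ : ℤ}
    (hα : u ∣ w * α ^ 2 + v) (hβ : v ∣ w * β ^ 2 + e * u) (hγ : w ∣ e * u * γ ^ 2 + v) :
    ∃ X Y Z : ℤ, w * X ^ 2 + e * u * Y ^ 2 + v * Z ^ 2 = u * v * w := by
  -- The lattice is given by `Y ≡ γZ` modulo `w` and `X ≡ aY + bZ` modulo `uv`. The congruences on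
  -- `a` and `b` make `wX² + euY² + vZ²` divisible by `uvw` on it.
  obtain ⟨a, ⟨a', ha⟩, ⟨a'', ha'⟩⟩ := Int.exists_dvd_sub_of_isCoprime huv 0 β
  obtain ⟨b, ⟨b', hb⟩, ⟨b'', hb'⟩⟩ := Int.exists_dvd_sub_of_isCoprime huv α 0
  rw [sub_zero] at ha hb'
  obtain ⟨t, ht⟩ : u * v ∣ a ^ 2 * w + e * u := by
    apply huv.mul_dvd
    · exact ⟨a' * a * w + e, by rw [ha]; ring⟩
    · obtain ⟨r, hr⟩ := hβ
      exact ⟨r + a'' * (a + β) * w, by linear_combination hr + w * (a + β) * ha'⟩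
  have hc0 : u * v * w ∣ w * (a * γ + b) ^ 2 + e * u * γ ^ 2 + v := by
    apply (huw.mul_left hvw).mul_dvd
    · apply huv.mul_dvd
      · obtain ⟨r, hr⟩ := hα
        refine ⟨w * a' * γ * (a * γ + 2 * b) + r + w * b' * (b + α) + e * γ ^ 2, ?_⟩
        linear_combination w * γ * (a * γ + 2 * b) * ha + hr + w * (b + α) * hb
      · refine ⟨u * t * γ ^ 2 + 2 * a * b'' * γ * w + w * b * b'' + 1, ?_⟩
        linear_combination γ ^ 2 * ht + (2 * a * γ * w + w * b) * hb'
    · obtain ⟨r, hr⟩ := hγ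
      exact ⟨(a * γ + b) ^ 2 + r, by linear_combination hr⟩
  obtain ⟨c, hc⟩ := hc0
  have hN : 0 < u * v * w := by positivity
  have hab : a * b = u * v * (a' * b'') := by rw [ha, hb']; ring
  -- The diagonal form has determinant `euvw` and the lattice index `uvw`; dividing the form by
  -- `uvw` leaves determinant `e`. The check goes through the two-by-two minors containing the
  -- leading entry `uv`.
  have hdet : u * v * (w * t) * c + 2 * (t * γ + a' * b'' * w) * (a * γ + b) * (a * w) -
      u * v * (t * γ + a' * b'' * w) ^ 2 - w * t * (a * γ + b) ^ 2 - c * (a * w) ^ 2 = e := by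
    have h1 : u * v * (w * t) - (a * w) ^ 2 = w * (e * u) := by linear_combination -w * ht
    have h2 : w * (u * v * c - (a * γ + b) ^ 2) = e * u * γ ^ 2 + v := by linear_combination -hc
    have h3 : u * v * (t * γ + a' * b'' * w) - a * w * (a * γ + b) = e * u * γ := by
      linear_combination -γ * ht - w * hab
    have h4 : u * v * (u * v * (w * t) * c + 2 * (t * γ + a' * b'' * w) * (a * γ + b) * (a * w) -
        u * v * (t * γ + a' * b'' * w) ^ 2 - w * t * (a * γ + b) ^ 2 - c * (a * w) ^ 2) =
        (u * v * (w * t) - (a * w) ^ 2) * (u * v * c - (a * γ + b) ^ 2) -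
        (u * v * (t * γ + a' * b'' * w) - a * w * (a * γ + b)) ^ 2 := by ring
    rw [h1, h3] at h4
    apply mul_left_cancel₀ (mul_pos hu hv).ne'
    rw [h4]
    linear_combination e * u * h2
  obtain ⟨x, y, z, n, hn, hn0, hn1⟩ := exists_reduced_ternary (u * v) (w * t) c
    (t * γ + a' * b'' * w) (a * γ + b) (a * w) (by positivity)
    (by
      have : u * v * (w * t) - (a * w) ^ 2 = w * (e * u) := by linear_combination -w * ht
      rw [this]; positivity)
    (by rw [hdet]; exact he)
  rw [hdet] at hn1
  -- Here `27n³ ≤ 64e ≤ 192`, below `27 · 2³ = 216`; this is where `e ≤ 3` matters.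
  have hn2 : n = 1 := by
    by_contra hne
    have : 2 ≤ n := by omega
    have : 2 ^ 3 ≤ n ^ 3 := by gcongr
    omega
  rw [hn2] at hn
  refine ⟨u * v * x + a * w * y + (a * γ + b) * z, w * y + γ * z, z, ?_⟩
  linear_combination (w ^ 2 * y ^ 2 + 2 * w * γ * y * z) * ht + 2 * w ^ 2 * y * z * hab +
    z ^ 2 * hc - u * v * w * hn

/-- The binary form with coefficients `n, s, c` has determinant 3, so it represents some `m ≤ 2`,
and `nm` has the shape `x² + 3y²`. The value `m = 2` fails modulo 4 because `n` is odd. -/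
theorem exists_eq_sq_add_three_mul_sq {n : ℕ} (hn : Odd n) {s : ℤ} (h : (n : ℤ) ∣ s ^ 2 + 3) :
    ∃ x y : ℤ, (n : ℤ) = x ^ 2 + 3 * y ^ 2 := by
  obtain ⟨c, hc⟩ := h
  have hn0 : (0 : ℤ) < n := by exact_mod_cast hn.pos
  obtain ⟨p, q, r, t, -, h1, h2⟩ := exists_reduced_binary n s c hn0 (by linarith)
  obtain ⟨m, hm⟩ : ∃ m, m = (n : ℤ) * p ^ 2 + 2 * s * p * r + c * r ^ 2 := ⟨_, rfl⟩
  rw [← hm] at h1 h2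
  have hmn : (n : ℤ) * m = (n * p + s * r) ^ 2 + 3 * r ^ 2 := by
    rw [hm]; linear_combination -r ^ 2 * hc
  have hm3 : m < 3 := by nlinarith
  have : m = 1 ∨ m = 2 := by omega
  rcases this with rfl | rfl
  · exact ⟨_, _, by rw [← hmn, mul_one]⟩
  · exfalso
    obtain ⟨k, hk⟩ := hn
    have h4 : ∀ x y : ZMod 4, x ^ 2 + 3 * y ^ 2 ≠ 2 := by decide
    refine h4 ((n * p + s * r : ℤ) : ZMod 4) (r : ZMod 4) ?_
    have := congrArg (Int.cast : ℤ → ZMod 4) hmn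
    have h40 : (4 : ZMod 4) = 0 := rfl
    rw [hk] at this ⊢
    push_cast at this ⊢
    rw [← this]
    linear_combination (k : ZMod 4) * h40

/-- Up to squares, `-a` is the product of its numerator and denominator, whose squarefree part is
`n`. -/
theorem exists_mul_sq_eq_neg_squarefree {a : ℚ} (ha : a < 0) :
    ∃ (n : ℕ) (r : ℚ), Squarefree n ∧ r ≠ 0 ∧ a * r ^ 2 = -n := by
  obtain ⟨s, b, hsb, hs⟩ := Nat.sq_mul_squarefree ((-a).num.natAbs * (-a).den)
  have hnum : 0 < (-a).num := Rat.num_pos.2 (neg_pos.2 ha)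
  have hden := (-a).den_pos
  have hb : b ≠ 0 := by
    rintro rfl
    have : 0 < (-a).num.natAbs * (-a).den := Nat.mul_pos (by omega) hden
    rw [← hsb] at this
    simp at this
  have hb' : (b : ℚ) ≠ 0 := by exact_mod_cast hb
  have hd' : ((-a).den : ℚ) ≠ 0 := by exact_mod_cast hden.ne'
  refine ⟨s, (-a).den / b, hs, div_ne_zero hd' hb', ?_⟩
  have h1 : ((-a).num : ℚ) = -a * (-a).den := (Rat.mul_den_eq_num (-a)).symm
  have h2 : (b : ℚ) ^ 2 * s = (-a).num * (-a).den := by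
    have : (b : ℤ) ^ 2 * s = (-a).num * (-a).den := by
      rw [← Int.natAbs_of_nonneg hnum.le]; exact_mod_cast hsb
    exact_mod_cast this
  rw [h1] at h2
  field_simp
  linear_combination h2

end Arithmetic

/-! ### Definite quaternion algebras split away from 2 and 3. -/

section Global

open QuaternionAlgebra (Basis)

/-- `A` contains anticommuting elements with squares `a` and `b`. -/
abbrev HasQuaternionBasis (A : Type*) [Ring A] [Algebra ℚ A] (a b : ℚ) : Prop :=
  Nonempty (Basis A a 0 b)

variable {A : Type*} [Ring A] [Algebra ℚ A] {a b : ℚ}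

theorem QuaternionAlgebra.Basis.exists_swap (q : Basis A a 0 b) : HasQuaternionBasis A b a := by
  refine ⟨(quaternionBasis (A := ℍ[ℚ,a,b]) (i := ⟨0, 0, 1, 0⟩) (j := ⟨0, 1, 0, 0⟩)
    ?_ ?_ ?_).compHom q.liftHom⟩ <;> ext <;> simp [QuaternionAlgebra.algebraMap_eq]

/-- The second slot of a quaternion algebra can be multiplied by norms. -/
theorem QuaternionAlgebra.Basis.exists_mul_norm (q : Basis A a 0 b) {c : ℚ} (x y : ℚ)
    (hc : b * (x ^ 2 - a * y ^ 2) = c) : HasQuaternionBasis A a c := by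
  subst hc
  refine ⟨(quaternionBasis (A := ℍ[ℚ,a,b]) (i := ⟨0, 1, 0, 0⟩) (j := ⟨0, 0, x, y⟩)
    ?_ ?_ ?_).compHom q.liftHom⟩ <;> ext <;> simp [QuaternionAlgebra.algebraMap_eq] <;> ring

/-- The value `c` is the square of the pure quaternion `x i + y j + z k`. -/
theorem QuaternionAlgebra.Basis.exists_pure_mul_self (q : Basis A a 0 b) {c : ℚ} (x y z : ℚ)
    (hc : a * x ^ 2 + b * y ^ 2 - a * b * z ^ 2 = c) : ∃ i : A, i * i = algebraMap ℚ A c := by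
  subst hc
  refine ⟨q.liftHom ⟨0, x, y, z⟩, ?_⟩
  rw [← map_mul, ← AlgHom.commutes q.liftHom]
  congr 1
  ext <;> simp [QuaternionAlgebra.algebraMap_eq] <;> ring

/-- Orthogonal pure quaternions anticommute, so two orthonormal vectors for `3x² + 2y² + 6z²`
suffice. -/
theorem QuaternionAlgebra.Basis.exists_neg_one_neg_one (q : Basis (R := ℚ) A (-3) 0 (-2)) :
    HasQuaternionBasis A (-1) (-1) := by
  refine ⟨(quaternionBasis (A := ℍ[ℚ,-3,-2]) (a := -1) (b := -1) (i := ⟨0, 1 / 3, 0, 1 / 3⟩)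
    (j := ⟨0, -1 / 3, 1 / 2, 1 / 6⟩) ?_ ?_ ?_).compHom q.liftHom⟩ <;>
  ext <;> simp [QuaternionAlgebra.algebraMap_eq] <;> norm_num

variable {D : Type*} [Ring D] [IsDomain D] [Algebra ℚ D]

/-- Contrapositive of `isNormFormAnisotropic_padic`: splitting at `p` becomes a quadratic residue
condition, the only way it enters the global argument. -/
theorem isSquare_of_not_isDivisionOver (hD : Module.finrank ℚ D = 4) {m c : ℕ}
    (q : HasQuaternionBasis D (-m) (-c)) (hm : m ≠ 0) (hc : c ≠ 0) {p : ℕ} [Fact p.Prime]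
    (hp : ¬IsDivisionOver ℚ_[p] D) (hpm : p ∣ m) (hpm' : ¬p ^ 2 ∣ m) :
    IsSquare (-(c : ZMod p)) := by
  by_contra h
  apply hp
  obtain ⟨q⟩ := q
  rw [q.isDivisionOver_iff hD (by simpa using hm) (by simpa using hc)]
  have := isNormFormAnisotropic_padic (p := p) (c := c) (m := m) (by simpa using h)
    (by exact_mod_cast hpm) (by exact_mod_cast hpm')
  simpa using this

theorem neg_of_isDivisionOver_real (hD : Module.finrank ℚ D = 4) (q : Basis D a 0 b)
    (ha : a ≠ 0) (hb : b ≠ 0) (h : IsDivisionOver ℝ D) : a < 0 ∧ b < 0 := by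
  rwa [q.isDivisionOver_iff hD ha hb, isNormFormAnisotropic_real_iff] at h

theorem ZMod.isSquare_two (x : ZMod 2) : IsSquare x := by
  revert x; decide

theorem Squarefree.not_sq_dvd_of_prime {m p : ℕ} (hm : Squarefree m) (hp : p.Prime) :
    ¬p ^ 2 ∣ m := by
  intro h
  rw [sq] at h
  exact hp.one_lt.ne' (Nat.isUnit_iff.1 (hm p h))

/-- A definite quaternion algebra split away from `2` and `3` contains `√-1` or `√-3`, according
to whether `3` is coprime to the coefficients of its norm form. -/
theorem exists_mul_self_eq_neg (hD : Module.finrank ℚ D = 4)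
    (hp : ∀ (p : ℕ) [Fact p.Prime], p ≠ 2 → p ≠ 3 → ¬IsDivisionOver ℚ_[p] D) {u v w e : ℕ}
    (hq : HasQuaternionBasis D (-(e * u * v : ℕ)) (-(v * w : ℕ))) (hsq : Squarefree (e * u * v * w))
    (he : e ≤ 3) (h3 : ¬3 ∣ u * v * w) : ∃ i : D, i * i = algebraMap ℚ D (-e) := by
  obtain ⟨q⟩ := hq
  obtain ⟨hcw, hsq3, hsw⟩ := Nat.squarefree_mul_iff.1 hsq
  obtain ⟨hcv, hsq2, hsv⟩ := Nat.squarefree_mul_iff.1 hsq3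
  obtain ⟨hcu, hse, hsu⟩ := Nat.squarefree_mul_iff.1 hsq2
  have he0 := hse.ne_zero
  have hu0 := hsu.ne_zero
  have hv0 := hsv.ne_zero
  have hw0 := hsw.ne_zero
  have heQ : (e : ℚ) ≠ 0 := by exact_mod_cast he0
  have huQ : (u : ℚ) ≠ 0 := by exact_mod_cast hu0
  have hvQ : (v : ℚ) ≠ 0 := by exact_mod_cast hv0
  have hwQ : (w : ℚ) ≠ 0 := by exact_mod_cast hw0
  have hcwv : Nat.Coprime v w := Nat.Coprime.coprime_mul_left hcw
  have hceuw : Nat.Coprime (e * u) w := Nat.Coprime.coprime_mul_right hcw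
  have hcuw : Nat.Coprime u w := Nat.Coprime.coprime_mul_left hceuw
  have hcuv : Nat.Coprime u v := Nat.Coprime.coprime_mul_left hcv
  -- Three presentations of `D`, with `u`, `v`, `w` in turn dividing the first slot, supply the
  -- residue conditions for the lattice. The prime 2 imposes none and 3 is excluded.
  have key : ∀ {m c n : ℕ}, HasQuaternionBasis D (-m) (-c) → Squarefree m → c ≠ 0 → n ∣ m →
      ¬3 ∣ n → ∀ p : ℕ, p.Prime → p ∣ n → IsSquare (-(c : ZMod p)) := by
    intro m c n q hm hc hnm h3n p hpp hpn
    by_cases hp2 : p = 2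
    · subst hp2
      exact ZMod.isSquare_two _
    · have hp3 : p ≠ 3 := by
        rintro rfl
        exact h3n hpn
      have : Fact p.Prime := ⟨hpp⟩
      exact isSquare_of_not_isDivisionOver hD q hm.ne_zero hc (hp p hp2 hp3) (hpn.trans hnm)
        (hm.not_sq_dvd_of_prime hpp)
  have hu3 : ¬3 ∣ u := fun h ↦ h3 ((h.mul_right v).mul_right w)
  have hv3 : ¬3 ∣ v := fun h ↦ h3 ((h.mul_left u).mul_right w)
  have hw3 : ¬3 ∣ w := fun h ↦ h3 (h.mul_left _)
  obtain ⟨α, hα⟩ := Int.exists_dvd_mul_sq_add (v := v) (w := w) hsu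
    (Nat.isCoprime_iff_coprime.2 hcuw) (by
      intro p hpp hpu
      have := key ⟨q⟩ hsq3 (mul_ne_zero hv0 hw0) (n := u)
        ((dvd_mul_left u e).mul_right v) hu3 p hpp hpu
      push_cast at this ⊢
      exact this)
  obtain ⟨β, hβ⟩ := Int.exists_dvd_mul_sq_add (v := e * u) (w := w) hsv
    (Nat.isCoprime_iff_coprime.2 hcwv) (by
      intro p hpp hpu
      -- Multiplying the second slot by the norm of `i / v` turns `-vw` into `-euw`.
      have q' : HasQuaternionBasis D (-(e * u * v : ℕ)) (-(e * u * w : ℕ)) :=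
        q.exists_mul_norm 0 (1 / v) (by push_cast; field_simp; ring)
      have := key q' hsq3 (mul_ne_zero (mul_ne_zero he0 hu0) hw0) (n := v)
        (dvd_mul_left v _) hv3 p hpp hpu
      push_cast at this ⊢
      exact this)
  obtain ⟨γ, hγ⟩ := Int.exists_dvd_mul_sq_add (v := v) (w := e * u) hsw
    (by exact_mod_cast Nat.isCoprime_iff_coprime.2 hceuw.symm) (by
      intro p hpp hpu
      have := key q.exists_swap (Nat.squarefree_mul_iff.2 ⟨hcwv, hsv, hsw⟩)
        (mul_ne_zero (mul_ne_zero he0 hu0) hv0) (n := w) (dvd_mul_left w _) hw3 p hpp hpu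
      push_cast at this ⊢
      rw [mul_comm (v : ZMod p)]
      exact this)
  obtain ⟨X, Y, Z, hXYZ⟩ := exists_ternary_solution (u := u) (v := v) (w := w) (e := e)
    (by omega) (by omega) (by omega) (by omega) (by omega)
    (Nat.isCoprime_iff_coprime.2 hcuv) (Nat.isCoprime_iff_coprime.2 hcuw)
    (Nat.isCoprime_iff_coprime.2 hcwv) hα hβ hγ
  -- With these coefficients the square is `-e (wX² + euY² + vZ²) / (uvw)`.
  refine q.exists_pure_mul_self (X / (u * v)) (e * Y / (v * w)) (Z / (u * v * w)) ?_
  have hXYZ' : (w * X ^ 2 + e * u * Y ^ 2 + v * Z ^ 2 : ℚ) = u * v * w := by exact_mod_cast hXYZ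
  push_cast
  field_simp
  linear_combination -hXYZ'

theorem HasQuaternionBasis.div_norm {k n : ℚ} (h : HasQuaternionBasis A a (-(k * n))) (hn : n ≠ 0)
    {x y : ℚ} (hxy : n = x ^ 2 - a * y ^ 2) : HasQuaternionBasis A a (-k) := by
  obtain ⟨q⟩ := h
  refine q.exists_mul_norm (x / n) (y / n) ?_
  have : (x / n) ^ 2 - a * (y / n) ^ 2 = (x ^ 2 - a * y ^ 2) / n ^ 2 := by ring
  rw [this, ← hxy]
  field_simp

theorem HasQuaternionBasis.exists_squarefree (h : HasQuaternionBasis A a b) (hb : b < 0) :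
    ∃ n : ℕ, Squarefree n ∧ HasQuaternionBasis A a (-n) := by
  obtain ⟨q⟩ := h
  obtain ⟨n, r, hn, -, hr⟩ := exists_mul_sq_eq_neg_squarefree hb
  exact ⟨n, hn, q.exists_mul_norm r 0 (by rw [← hr]; ring)⟩

theorem Squarefree.exists_eq_mul_of_prime {n p : ℕ} (hn : Squarefree n) (hp : p.Prime) :
    ∃ k m, n = k * m ∧ (k = 1 ∨ k = p) ∧ Squarefree m ∧ ¬p ∣ m := by
  by_cases h : p ∣ n
  · obtain ⟨m, rfl⟩ := h
    obtain ⟨hc, -, hm⟩ := Nat.squarefree_mul_iff.1 hn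
    exact ⟨p, m, rfl, Or.inr rfl, hm, (Nat.Prime.coprime_iff_not_dvd hp).1 hc⟩
  · exact ⟨1, n, (one_mul n).symm, Or.inl rfl, hn, h⟩

/-- A square root of `-e` is not rational, so it extends to a basis; definiteness makes the other
slot negative. Splitting at `p` is read in the swapped basis, where `p` divides the first slot
exactly. -/
theorem exists_squarefree_basis_of_mul_self_eq_neg [Algebra.IsCentral ℚ D]
    (hD : Module.finrank ℚ D = 4) (hinf : IsDivisionOver ℝ D)
    (hp : ∀ (p : ℕ) [Fact p.Prime], p ≠ 2 → p ≠ 3 → ¬IsDivisionOver ℚ_[p] D) {e : ℕ} (he : e ≠ 0)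
    {i : D} (hi : i * i = algebraMap ℚ D (-e)) :
    ∃ n : ℕ, Squarefree n ∧ HasQuaternionBasis D (-e) (-n) ∧
      ∀ p : ℕ, p.Prime → p ∣ n → p ≠ 2 → p ≠ 3 → IsSquare (-(e : ZMod p)) := by
  have he' : (0 : ℚ) < e := by exact_mod_cast Nat.pos_of_ne_zero he
  obtain ⟨ha, b, hb, ⟨q⟩⟩ := exists_basis_of_sq hD hi (by
    rintro r rfl
    rw [← map_mul] at hi
    have := (algebraMap ℚ D).injective hi
    nlinarith [mul_self_nonneg r])
  obtain ⟨n, hn, hq⟩ :=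
    HasQuaternionBasis.exists_squarefree ⟨q⟩ (neg_of_isDivisionOver_real hD q ha hb hinf).2
  refine ⟨n, hn, hq, fun p hpp hpn hp2 hp3 ↦ ?_⟩
  have : Fact p.Prime := ⟨hpp⟩
  obtain ⟨q⟩ := hq
  exact isSquare_of_not_isDivisionOver hD q.exists_swap hn.ne_zero he (hp p hp2 hp3) hpn
    (hn.not_sq_dvd_of_prime hpp)

/-- In `D = (-1, -n)` the part of `n` prime to 3 is a sum of two squares, hence a norm from `ℚ(i)`,
and cancels; the factor 1 or 3 remains. -/
theorem hasQuaternionBasis_of_mul_self_eq_neg_one [Algebra.IsCentral ℚ D]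
    (hD : Module.finrank ℚ D = 4) (hinf : IsDivisionOver ℝ D)
    (hp : ∀ (p : ℕ) [Fact p.Prime], p ≠ 2 → p ≠ 3 → ¬IsDivisionOver ℚ_[p] D)
    {i : D} (hi : i * i = algebraMap ℚ D (-(1 : ℕ))) :
    HasQuaternionBasis D (-1) (-1) ∨ HasQuaternionBasis D (-1) (-3) := by
  obtain ⟨n, hn, hq, hsq⟩ :=
    exists_squarefree_basis_of_mul_self_eq_neg hD hinf hp one_ne_zero hi
  obtain ⟨k, m, rfl, hk, hm, hm3⟩ := hn.exists_eq_mul_of_prime Nat.prime_three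
  obtain ⟨s, hs⟩ := Int.exists_dvd_sq_sub_of_squarefree hm (m := -1) (by
    intro p hpp hpm
    by_cases hp2 : p = 2
    · subst hp2
      exact ZMod.isSquare_two _
    · have := hsq p hpp (hpm.mul_left k) hp2 (by rintro rfl; exact hm3 hpm)
      simpa using this)
  obtain ⟨x, y, hxy⟩ := Nat.eq_sq_add_sq_of_isSquare_mod_neg_one (n := m) ⟨(s : ZMod m), by
    rw [← ZMod.intCast_zmod_eq_zero_iff_dvd] at hs
    push_cast at hs
    linear_combination -hs⟩
  have hq' : HasQuaternionBasis D (-1) (-k) := by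
    have hm0 : (m : ℚ) ≠ 0 := by exact_mod_cast hm.ne_zero
    have hq1 : HasQuaternionBasis D (-1) (-(k * m)) := by simpa using hq
    refine hq1.div_norm hm0 (x := x) (y := y) ?_
    rw [hxy]; push_cast; ring
  rcases hk with rfl | rfl
  · exact Or.inl (by simpa using hq')
  · exact Or.inr (by simpa using hq')

/-- In `D = (-3, -n)` the part of `n` prime to 6 has the shape `x² + 3y²` and cancels, as does 3,
the norm of `√-3`. What remains is `(-3, -1)` or `(-3, -2)`, the latter being `(-1, -1)`. -/
theorem hasQuaternionBasis_of_mul_self_eq_neg_three [Algebra.IsCentral ℚ D]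
    (hD : Module.finrank ℚ D = 4) (hinf : IsDivisionOver ℝ D)
    (hp : ∀ (p : ℕ) [Fact p.Prime], p ≠ 2 → p ≠ 3 → ¬IsDivisionOver ℚ_[p] D)
    {i : D} (hi : i * i = algebraMap ℚ D (-(3 : ℕ))) :
    HasQuaternionBasis D (-1) (-1) ∨ HasQuaternionBasis D (-1) (-3) := by
  obtain ⟨n, hn, hq, hsq⟩ :=
    exists_squarefree_basis_of_mul_self_eq_neg hD hinf hp three_ne_zero hi
  obtain ⟨k, m, rfl, hk, hm, hm3⟩ := hn.exists_eq_mul_of_prime Nat.prime_three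
  obtain ⟨l, t, rfl, hl, ht, ht2⟩ := hm.exists_eq_mul_of_prime Nat.prime_two
  obtain ⟨s, hs⟩ := Int.exists_dvd_sq_sub_of_squarefree ht (m := -3) (by
    intro p hpp hpt
    have := hsq p hpp ((hpt.mul_left l).mul_left k) (by rintro rfl; exact ht2 hpt)
      (by rintro rfl; exact hm3 (hpt.mul_left l))
    simpa using this)
  obtain ⟨x, y, hxy⟩ := exists_eq_sq_add_three_mul_sq (n := t)
    (by rwa [← Nat.not_even_iff_odd, even_iff_two_dvd]) (s := s) (by simpa using hs)
  have hq' : HasQuaternionBasis D (-3) (-(k * l)) := by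
    have ht0 : (t : ℚ) ≠ 0 := by exact_mod_cast ht.ne_zero
    have hq1 : HasQuaternionBasis D (-3) (-(k * l * t)) := by simpa [mul_assoc] using hq
    refine hq1.div_norm ht0 (x := x) (y := y) ?_
    have : (t : ℚ) = x ^ 2 + 3 * y ^ 2 := by exact_mod_cast hxy
    rw [this]; ring
  have hq'' : HasQuaternionBasis D (-3) (-l) := by
    rcases hk with rfl | rfl
    · simpa using hq'
    · refine HasQuaternionBasis.div_norm (k := l) (n := 3) (by simpa [mul_comm] using hq')
        (by norm_num) (x := 0) (y := 1) (by norm_num)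
  obtain ⟨q⟩ := hq''
  rcases hl with rfl | rfl
  · right
    simpa using q.exists_swap
  · left
    have hq2 : HasQuaternionBasis D (-3) (-2) := by simpa using (⟨q⟩ : HasQuaternionBasis D _ _)
    obtain ⟨q⟩ := hq2
    exact q.exists_neg_one_neg_one

/-- A definite rational quaternion algebra split at all primes other than `2` and `3` is
`(-1, -1)` or `(-1, -3)`. -/
theorem hasQuaternionBasis_of_definite [Algebra.IsCentral ℚ D]
    (hD : Module.finrank ℚ D = 4) (hinf : IsDivisionOver ℝ D)
    (hp : ∀ (p : ℕ) [Fact p.Prime], p ≠ 2 → p ≠ 3 → ¬IsDivisionOver ℚ_[p] D) :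
    HasQuaternionBasis D (-1) (-1) ∨ HasQuaternionBasis D (-1) (-3) := by
  obtain ⟨a, b, ha, hb, ⟨q⟩⟩ := exists_quaternion_basis hD
  obtain ⟨ha', hb'⟩ := neg_of_isDivisionOver_real hD q ha hb hinf
  obtain ⟨B, hB, ⟨q⟩⟩ := HasQuaternionBasis.exists_squarefree ⟨q⟩ hb'
  obtain ⟨A, hA, ⟨q⟩⟩ := q.exists_swap.exists_squarefree ha'
  obtain ⟨v, u, w, hv0, hcop, rfl, rfl⟩ : ∃ v u w : ℕ, 0 < v ∧ Nat.Coprime u w ∧ A = u * v ∧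
      B = w * v := by
    obtain ⟨g, u, w, hg, hc, h1, h2⟩ := Nat.exists_coprime' (m := A) (n := B)
      (Nat.gcd_pos_of_pos_left _ (Nat.pos_of_ne_zero hA.ne_zero))
    exact ⟨g, u, w, hg, hc, h1, h2⟩
  have hvQ : (v : ℚ) ≠ 0 := by exact_mod_cast hv0.ne'
  obtain ⟨hcuv, hu, hv⟩ := Nat.squarefree_mul_iff.1 hA
  obtain ⟨hcwv, hw, -⟩ := Nat.squarefree_mul_iff.1 hB
  have hsq : Squarefree (u * v * w) :=
    Nat.squarefree_mul_iff.2 ⟨Nat.Coprime.mul_left hcop hcwv.symm, hA, hw⟩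
  have q1 : HasQuaternionBasis D (-(u * v : ℕ)) (-(v * w : ℕ)) := by
    have := q.exists_swap
    rwa [mul_comm w v] at this
  -- Up to squares `i`, `j`, `ij` square to `-uv`, `-vw`, `-uw`, so `u, v, w` may be permuted: 3 is
  -- moved into `u` and split off as `e = 3`. If 3 is absent, `e = 1`.
  by_cases h3 : 3 ∣ u * v * w
  · have main : ∀ {u v w : ℕ}, HasQuaternionBasis D (-(u * v : ℕ)) (-(v * w : ℕ)) →
        Squarefree (u * v * w) → 3 ∣ u →
        HasQuaternionBasis D (-1) (-1) ∨ HasQuaternionBasis D (-1) (-3) := by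
      rintro u v w q hsq ⟨u, rfl⟩
      have h3 : ¬3 ∣ u * v * w := by
        have : Squarefree (3 * (u * v * w)) := by convert hsq using 1; ring
        exact (Nat.Prime.coprime_iff_not_dvd Nat.prime_three).1 (Nat.squarefree_mul_iff.1 this).1
      obtain ⟨i, hi⟩ := exists_mul_self_eq_neg hD hp q hsq le_rfl h3
      exact hasQuaternionBasis_of_mul_self_eq_neg_three hD hinf hp hi
    rcases (Nat.prime_three.dvd_mul).1 h3 with h3 | h3w
    · rcases (Nat.prime_three.dvd_mul).1 h3 with h3u | h3v
      · exact main q1 hsq h3u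
      · refine main (u := v) (v := u) (w := w) ?_ (by rwa [mul_comm v u]) h3v
        obtain ⟨q⟩ := q1
        rw [mul_comm v u]
        exact q.exists_mul_norm 0 (1 / v) (by push_cast; field_simp; ring)
    · obtain ⟨q⟩ := q1
      refine main (u := w) (v := v) (w := u) ?_ (by convert hsq using 1; ring) h3w
      rw [mul_comm w v, mul_comm v u]
      exact q.exists_swap
  · obtain ⟨i, hi⟩ := exists_mul_self_eq_neg (u := u) (v := v) (w := w) (e := 1) hD hp
      (by simpa using q1) (by simpa using hsq) (by norm_num) h3
    exact hasQuaternionBasis_of_mul_self_eq_neg_one hD hinf hp hi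

end Global

/-! ### The ramification sets `{2, ∞}` and `{3, ∞}`. -/

section Ramification

open QuaternionAlgebra (Basis)

theorem ZMod.not_isSquare_neg_one_three : ¬IsSquare (-((1 : ℤ) : ZMod 3)) := by decide

theorem ramificationSet_eq_of_forall {D : Type*} [Ring D] [Algebra ℚ D] {P : ℕ}
    (hP : P.Prime) (hinf : IsDivisionOver ℝ D)
    (h : ∀ (p : ℕ) [Fact p.Prime], IsDivisionOver ℚ_[p] D ↔ p = P) :
    ramificationSet D = {.finite P hP, .infinite} := by
  ext v
  cases v with
  | finite p hp =>
    have : Fact p.Prime := ⟨hp⟩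
    simpa [ramificationSet, IsRamifiedAt] using h p
  | infinite => simpa [ramificationSet, IsRamifiedAt] using hinf

variable {D : Type*} [Ring D] [IsDomain D] [Algebra ℚ D]

theorem isDivisionOver_real_of_neg (hD : Module.finrank ℚ D = 4) {a b : ℚ} (ha : a < 0)
    (hb : b < 0) (h : HasQuaternionBasis D a b) : IsDivisionOver ℝ D := by
  obtain ⟨q⟩ := h
  rw [q.isDivisionOver_iff hD ha.ne hb.ne, isNormFormAnisotropic_real_iff]
  exact ⟨ha, hb⟩

theorem HasQuaternionBasis.ramificationSet_eq_two (hD : Module.finrank ℚ D = 4)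
    (h : HasQuaternionBasis D (-1) (-1)) : ramificationSet D = {placeTwo, .infinite} := by
  refine ramificationSet_eq_of_forall Nat.prime_two
    (isDivisionOver_real_of_neg hD (by norm_num) (by norm_num) h) fun p _ ↦ ?_
  obtain ⟨q⟩ := h
  rw [q.isDivisionOver_iff hD (by norm_num) (by norm_num)]
  constructor
  · intro h
    by_contra hp
    refine not_isNormFormAnisotropic_padic hp (c := 1) ?_ (by simpa using h)
    exact_mod_cast (Fact.out : p.Prime).not_dvd_one
  · rintro rfl
    exact isNormFormAnisotropic_two

theorem HasQuaternionBasis.ramificationSet_eq_three (hD : Module.finrank ℚ D = 4)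
    (h : HasQuaternionBasis D (-1) (-3)) : ramificationSet D = {placeThree, .infinite} := by
  refine ramificationSet_eq_of_forall Nat.prime_three
    (isDivisionOver_real_of_neg hD (by norm_num) (by norm_num) h) fun p _ ↦ ?_
  obtain ⟨q⟩ := h
  constructor
  · rw [q.isDivisionOver_iff hD (by norm_num) (by norm_num)]
    intro h
    by_contra hp
    by_cases hp2 : p = 2
    · subst hp2
      exact not_isNormFormAnisotropic_two h
    · refine not_isNormFormAnisotropic_padic hp2 (c := 3) ?_ (by simpa using h)
      have : ¬p ∣ 3 := by rwa [Nat.prime_dvd_prime_iff_eq Fact.out Nat.prime_three]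
      exact_mod_cast this
  · rintro rfl
    -- In `(-3, -1)` the prime 3 divides the first slot exactly, and `-1` is not a square modulo 3.
    obtain ⟨q⟩ := q.exists_swap
    rw [q.isDivisionOver_iff hD (by norm_num) (by norm_num)]
    simpa using isNormFormAnisotropic_padic (p := 3) (c := 1) (m := 3)
      ZMod.not_isSquare_neg_one_three (by norm_num) (by norm_num)

theorem placeTwo_ne_placeThree : placeTwo ≠ placeThree := by
  simp [placeTwo, placeThree]

theorem pair_placeTwo_ne : ({placeTwo, .infinite} : Set RatPlace) ≠ {placeThree, .infinite} := by
  intro h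
  have : placeTwo ∈ ({placeThree, .infinite} : Set RatPlace) := h ▸ Set.mem_insert _ _
  rcases this with h | h
  · exact placeTwo_ne_placeThree h
  · cases h

theorem hasQuaternionBasis_of_ramificationSet [Algebra.IsCentral ℚ D]
    (hD : Module.finrank ℚ D = 4) {P : ℕ} (hP : P.Prime) (hP' : P = 2 ∨ P = 3)
    (h : ramificationSet D = {.finite P hP, .infinite}) :
    HasQuaternionBasis D (-1) (-1) ∨ HasQuaternionBasis D (-1) (-3) := by
  refine hasQuaternionBasis_of_definite hD ?_ fun p hp hp2 hp3 hdiv ↦ ?_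
  · have : RatPlace.infinite ∈ ramificationSet D := by rw [h]; simp
    exact this
  · have : RatPlace.finite p hp.out ∈ ramificationSet D := hdiv
    rw [h] at this
    simp at this
    omega

theorem ramificationSet_eq_two_iff [Algebra.IsCentral ℚ D] (hD : Module.finrank ℚ D = 4) :
    ramificationSet D = {placeTwo, .infinite} ↔ HasQuaternionBasis D (-1) (-1) := by
  refine ⟨fun h ↦ ?_, fun h ↦ h.ramificationSet_eq_two hD⟩
  refine (hasQuaternionBasis_of_ramificationSet hD Nat.prime_two (Or.inl rfl) h).resolve_right
    fun h' ↦ pair_placeTwo_ne (h.symm.trans (h'.ramificationSet_eq_three hD))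

theorem ramificationSet_eq_three_iff [Algebra.IsCentral ℚ D] (hD : Module.finrank ℚ D = 4) :
    ramificationSet D = {placeThree, .infinite} ↔ HasQuaternionBasis D (-1) (-3) := by
  refine ⟨fun h ↦ ?_, fun h ↦ h.ramificationSet_eq_three hD⟩
  refine (hasQuaternionBasis_of_ramificationSet hD Nat.prime_three (Or.inr rfl) h).resolve_left
    fun h' ↦ pair_placeTwo_ne ((h'.ramificationSet_eq_two hD).symm.trans h)

end Ramification

/-! ### Traces of elements of finite order. -/

section FiniteOrder

/-- The totients of 8, 9, 12 and of each prime `p ≥ 5` exceed 2, so `n` is a proper divisor of 12.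
-/
theorem Nat.dvd_four_or_dvd_six_of_totient_le_two {n : ℕ} (hn : 0 < n) (h : n.totient ≤ 2) :
    n ∣ 4 ∨ n ∣ 6 := by
  have hle : ∀ {m}, m ∣ n → m.totient ≤ 2 := fun hm ↦
    (Nat.le_of_dvd (Nat.totient_pos.2 hn) (Nat.totient_dvd_of_dvd hm)).trans h
  have h8 : ¬8 ∣ n := fun h ↦ absurd (hle h) (by decide)
  have h9 : ¬9 ∣ n := fun h ↦ absurd (hle h) (by decide)
  have h12 : ¬12 ∣ n := fun h ↦ absurd (hle h) (by decide)
  have hdvd : n ∣ 12 := by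
    rw [Nat.dvd_iff_prime_pow_dvd_dvd]
    intro p k hp hk
    rcases Nat.eq_zero_or_pos k with rfl | hk0
    · simp
    have hpn : p ∣ n := (dvd_pow_self p hk0.ne').trans hk
    have hp3 : p ≤ 3 := by
      have := hle hpn
      rw [Nat.totient_prime hp] at this
      omega
    have hp2 := hp.two_le
    interval_cases p
    · have : k < 3 := by
        by_contra! hk3
        exact h8 ((pow_dvd_pow 2 hk3).trans hk)
      interval_cases k <;> norm_num
    · have : k < 2 := by
        by_contra! hk3
        exact h9 ((pow_dvd_pow 3 hk3).trans hk)
      interval_cases k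
      norm_num
  have h13 : n ≤ 12 := Nat.le_of_dvd (by norm_num) hdvd
  interval_cases n <;> omega

variable {D : Type*} [Ring D] [IsDomain D] [Algebra ℚ D]

/-- A root of unity of degree at most two over `ℚ` has integral trace between `-2` and `2`. -/
theorem exists_int_mul_self_add_one_eq {g : D} {n : ℕ} (hn : 0 < n) (hg : g ^ n = 1) {s t : ℚ}
    (hst : g * g = s • g + algebraMap ℚ D t) :
    ∃ t : ℤ, -2 ≤ t ∧ t ≤ 2 ∧ g * g + 1 = t * g := by
  open Polynomial in
  have hmon : (X ^ 2 - (C s * X + C t) : ℚ[X]).Monic := by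
    apply monic_X_pow_sub
    compute_degree!
  have hdeg : (minpoly ℚ g).degree ≤ 2 := by
    refine (minpoly.min ℚ g hmon ?_).trans (by compute_degree!)
    simp [sq, hst, Algebra.smul_def]
  have hint : IsIntegral ℚ g := ⟨_, hmon, by
    rw [← Polynomial.aeval_def]; simp [sq, hst, Algebra.smul_def]⟩
  have hprime := (minpoly.irreducible hint).prime
  -- The minimal polynomial divides a product of cyclotomic polynomials, so it is one of them, and
  -- its degree is at most two.
  have hdvd : minpoly ℚ g ∣ Polynomial.X ^ n - 1 := minpoly.dvd ℚ g (by simp [hg])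
  rw [← Polynomial.prod_cyclotomic_eq_X_pow_sub_one hn] at hdvd
  obtain ⟨d, hd, hdvd⟩ := (hprime.dvd_finsetProd_iff _).1 hdvd
  have hd0 : 0 < d := Nat.pos_of_mem_divisors hd
  have heq : minpoly ℚ g = Polynomial.cyclotomic d ℚ :=
    Polynomial.eq_of_monic_of_associated (minpoly.monic hint) (Polynomial.cyclotomic.monic d ℚ)
      ((minpoly.irreducible hint).associated_of_dvd (Polynomial.cyclotomic.irreducible_rat hd0)
        hdvd)
  have hgd : g ^ d = 1 := by
    have h1 : minpoly ℚ g ∣ Polynomial.X ^ d - 1 := by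
      rw [heq]; exact Polynomial.cyclotomic.dvd_X_pow_sub_one d ℚ
    have := (minpoly.dvd_iff).1 h1
    simpa [sub_eq_zero] using this
  have htot : d.totient ≤ 2 := by
    rw [heq, Polynomial.degree_cyclotomic] at hdeg
    exact_mod_cast hdeg
  have h01 : g = 1 ∨ g = -1 → ∃ t : ℤ, -2 ≤ t ∧ t ≤ 2 ∧ g * g + 1 = t * g := by
    rintro (h | h)
    · exact ⟨2, by norm_num, by norm_num, by rw [h]; norm_num⟩
    · exact ⟨-2, by norm_num, by norm_num, by rw [h]; norm_num⟩
  rcases Nat.dvd_four_or_dvd_six_of_totient_le_two hd0 htot with h | h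
  · have h4 : g ^ 4 = 1 := by
      obtain ⟨k, hk⟩ := h
      rw [hk, pow_mul, hgd, one_pow]
    have : (g - 1) * ((g + 1) * (g * g + 1)) = 0 := by
      have : (g - 1) * ((g + 1) * (g * g + 1)) = g ^ 4 - 1 := by noncomm_ring
      rw [this, h4, sub_self]
    rcases mul_eq_zero.1 this with h | h
    · exact h01 (Or.inl (sub_eq_zero.1 h))
    rcases mul_eq_zero.1 h with h | h
    · exact h01 (Or.inr (eq_neg_of_add_eq_zero_left h))
    · exact ⟨0, by norm_num, by norm_num, by rw [h]; simp⟩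
  · have h6 : g ^ 6 = 1 := by
      obtain ⟨k, hk⟩ := h
      rw [hk, pow_mul, hgd, one_pow]
    have : (g - 1) * ((g + 1) * ((g * g + g + 1) * (g * g - g + 1))) = 0 := by
      have : (g - 1) * ((g + 1) * ((g * g + g + 1) * (g * g - g + 1))) = g ^ 6 - 1 := by
        noncomm_ring
      rw [this, h6, sub_self]
    rcases mul_eq_zero.1 this with h | h
    · exact h01 (Or.inl (sub_eq_zero.1 h))
    rcases mul_eq_zero.1 h with h | h
    · exact h01 (Or.inr (eq_neg_of_add_eq_zero_left h))
    rcases mul_eq_zero.1 h with h | h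
    · refine ⟨-1, by norm_num, by norm_num, ?_⟩
      rw [← sub_eq_zero, ← h]
      push_cast
      noncomm_ring
    · refine ⟨1, by norm_num, by norm_num, ?_⟩
      rw [← sub_eq_zero, ← h]
      push_cast
      noncomm_ring

end FiniteOrder

/-! ### Homomorphisms from dicyclic groups. -/

section QuaternionGroupHom

variable {G : Type*} [Group G] {n : ℕ}

/-- The homomorphism from a generalised quaternion group given by elements satisfying
its defining relations. -/
theorem QuaternionGroup.exists_hom {ζ x : G} (hζ : ζ ^ (2 * n) = 1) (hx : x ^ 2 = ζ ^ n)
    (hxζ : ζ * x = x * ζ⁻¹) :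
    ∃ φ : QuaternionGroup n →* G, ∀ k : ℤ, φ (.a k) = ζ ^ k ∧ φ (.xa k) = x * ζ ^ k := by
  let f : ZMod (2 * n) →+ Additive G := ZMod.lift (2 * n) ⟨zmultiplesHom (Additive G) (.ofMul ζ), by
    rw [zmultiplesHom_apply, ← ofMul_zpow]
    exact_mod_cast congrArg Additive.ofMul hζ⟩
  let z : ZMod (2 * n) → G := fun i ↦ (f i).toMul
  have hzk : ∀ k : ℤ, z k = ζ ^ k := by
    intro k
    simp [z, f]
  have hadd : ∀ i j, z (i + j) = z i * z j := by
    intro i j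
    simp [z]
  have hzx : ∀ i, z i * x = x * z (-i) := by
    intro i
    obtain ⟨k, rfl⟩ := ZMod.intCast_surjective i
    rw [← Int.cast_neg, hzk, hzk]
    have : SemiconjBy x ζ⁻¹ ζ := hxζ.symm
    have h2 := this.zpow_right k
    rw [inv_zpow'] at h2
    exact h2.eq.symm
  have hxx : x * x = z n := by
    have := hzk n
    rw [Int.cast_natCast] at this
    rw [this, ← sq, hx, zpow_natCast]
  refine ⟨MonoidHom.mk' (fun g ↦ match g with | .a i => z i | .xa i => x * z i) ?_, fun k ↦
    ⟨hzk k, congrArg (x * ·) (hzk k)⟩⟩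
  rintro (i | i) (j | j)
  · simp [hadd]
  · simp only [QuaternionGroup.a_mul_xa]
    rw [← mul_assoc, hzx, mul_assoc, ← hadd]
    congr 2; ring
  · simp [hadd, mul_assoc]
  · simp only [QuaternionGroup.xa_mul_xa]
    rw [mul_assoc, ← mul_assoc (z i), hzx, mul_assoc x (z (-i)), ← mul_assoc x x, hxx, ← hadd,
      ← hadd]
    congr 1; ring

/-- The order of `ζ` makes the map injective on the rotations; if `x ζ ^ k = 1`, then `x` would be a
power of `ζ` and commute with it. -/
theorem QuaternionGroup.exists_injective_hom {ζ x : G} (hζ : orderOf ζ = 2 * n)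
    (hx : x ^ 2 = ζ ^ n) (hxζ : ζ * x = x * ζ⁻¹) (hne : ζ * x ≠ x * ζ) :
    ∃ φ : QuaternionGroup n →* G, Function.Injective φ ∧
      ∀ k : ℤ, φ (.a k) = ζ ^ k ∧ φ (.xa k) = x * ζ ^ k := by
  obtain ⟨φ, hφ⟩ := QuaternionGroup.exists_hom (hζ ▸ pow_orderOf_eq_one ζ) hx hxζ
  refine ⟨φ, ?_, hφ⟩
  rw [injective_iff_map_eq_one]
  rintro (i | i) h
  · obtain ⟨k, rfl⟩ := ZMod.intCast_surjective i
    rw [(hφ k).1, ← orderOf_dvd_iff_zpow_eq_one, hζ] at h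
    rw [QuaternionGroup.one_def, (ZMod.intCast_zmod_eq_zero_iff_dvd k (2 * n)).2 h]
  · obtain ⟨k, rfl⟩ := ZMod.intCast_surjective i
    rw [(hφ k).2, mul_eq_one_iff_eq_inv] at h
    exact absurd (h ▸ ((Commute.refl ζ).zpow_right k).inv_right.eq) hne

end QuaternionGroupHom

/-! ### Hurwitz units and integrality of traces. -/

section BinaryTetrahedral

/-- Squares are 0 or 1 modulo 4, so a sum of four divisible by 4 has all terms of one parity. -/
theorem Int.exists_eq_two_mul_add_of_sq_sum_eq_four {a b c d : ℤ}
    (h : a ^ 2 + b ^ 2 + c ^ 2 + d ^ 2 = 4) :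
    ∃ a' b' c', a = 2 * a' + d ∧ b = 2 * b' + d ∧ c = 2 * c' + d := by
  have key : ∀ a b c d : ZMod 4, a ^ 2 + b ^ 2 + c ^ 2 + d ^ 2 = 0 →
      2 * (a - d) = 0 ∧ 2 * (b - d) = 0 ∧ 2 * (c - d) = 0 := by decide
  obtain ⟨h1, h2, h3⟩ := key a b c d (by
    have := congrArg (Int.cast : ℤ → ZMod 4) h
    push_cast at this
    rw [this]; rfl)
  have hz : ∀ x : ℤ, 2 * (x - d : ZMod 4) = 0 → (4 : ℤ) ∣ 2 * (x - d) := by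
    intro x hx
    have : ((2 * (x - d) : ℤ) : ZMod 4) = 0 := by push_cast; exact hx
    exact_mod_cast (ZMod.intCast_zmod_eq_zero_iff_dvd _ 4).1 this
  have h1 := hz a h1
  have h2 := hz b h2
  have h3 := hz c h3
  exact ⟨(a - d) / 2, (b - d) / 2, (c - d) / 2, by omega, by omega, by omega⟩

/-- The quaternion with the given doubled coordinates. -/
def halfQuaternion (v : ℤ × ℤ × ℤ × ℤ) : ℍ[ℚ] :=
  ⟨v.1 / 2, v.2.1 / 2, v.2.2.1 / 2, v.2.2.2 / 2⟩

theorem halfQuaternion_injective : Function.Injective halfQuaternion := by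
  rintro ⟨a, b, c, d⟩ ⟨a', b', c', d'⟩ h
  have h0 := congrArg QuaternionAlgebra.re h
  have h1 := congrArg QuaternionAlgebra.imI h
  have h2 := congrArg QuaternionAlgebra.imJ h
  have h3 := congrArg QuaternionAlgebra.imK h
  simp [halfQuaternion] at h0 h1 h2 h3
  simp [h0, h1, h2, h3]

theorem normSq_halfQuaternion (v : ℤ × ℤ × ℤ × ℤ) : Quaternion.normSq (halfQuaternion v) =
    ((v.1 ^ 2 + v.2.1 ^ 2 + v.2.2.1 ^ 2 + v.2.2.2 ^ 2 : ℤ) : ℚ) / 4 := by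
  rw [Quaternion.normSq_def', halfQuaternion]
  push_cast
  ring

theorem isHurwitz_halfQuaternion {v : ℤ × ℤ × ℤ × ℤ}
    (hv : Quaternion.normSq (halfQuaternion v) = 1) : IsHurwitz (halfQuaternion v) := by
  obtain ⟨a, b, c, d⟩ := v
  rw [normSq_halfQuaternion, div_eq_one_iff_eq (by norm_num)] at hv
  obtain ⟨a, b, c, rfl, rfl, rfl⟩ := Int.exists_eq_two_mul_add_of_sq_sum_eq_four
    (a := a) (b := b) (c := c) (d := d) (by exact_mod_cast hv)
  refine ⟨a, b, c, d, ?_, ?_, ?_, rfl⟩ <;> simp only [halfQuaternion] <;> push_cast <;> ring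

/-- The doubled coordinates of the Hurwitz units. -/
noncomputable def hurwitzUnitCoords : Finset (ℤ × ℤ × ℤ × ℤ) :=
  (Finset.Icc (-2) 2 ×ˢ Finset.Icc (-2) 2 ×ˢ Finset.Icc (-2) 2 ×ˢ Finset.Icc (-2) 2).filter
    fun v ↦ v.1 ^ 2 + v.2.1 ^ 2 + v.2.2.1 ^ 2 + v.2.2.2 ^ 2 = 4

theorem card_hurwitzUnitCoords : hurwitzUnitCoords.card = 24 := by
  decide +kernel

theorem setOf_hurwitz_units_eq : {x : ℍ[ℚ] | IsHurwitz x ∧ Quaternion.normSq x = 1} =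
    halfQuaternion '' hurwitzUnitCoords := by
  ext x
  constructor
  · rintro ⟨⟨a, b, c, d, h0, h1, h2, h3⟩, hx⟩
    have hx' : halfQuaternion (2 * a + d, 2 * b + d, 2 * c + d, d) = x := by
      ext <;> simp only [halfQuaternion, h0, h1, h2, h3] <;> push_cast <;> ring
    refine ⟨_, ?_, hx'⟩
    rw [← hx', normSq_halfQuaternion, div_eq_one_iff_eq (by norm_num)] at hx
    have hx4 : (2 * a + d) ^ 2 + (2 * b + d) ^ 2 + (2 * c + d) ^ 2 + d ^ 2 = 4 := by
      exact_mod_cast hx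
    have hb : ∀ z : ℤ, z ^ 2 ≤ 4 → -2 ≤ z ∧ z ≤ 2 := fun z hz ↦
      abs_le.1 (abs_le_of_sq_le_sq (by linarith) (by norm_num))
    have s0 := sq_nonneg (2 * a + d)
    have s1 := sq_nonneg (2 * b + d)
    have s2 := sq_nonneg (2 * c + d)
    have s3 := sq_nonneg d
    simp only [hurwitzUnitCoords, Finset.coe_filter, Finset.mem_product, Finset.mem_Icc,
      Set.mem_ofPred_eq]
    exact ⟨⟨hb _ (by linarith), hb _ (by linarith), hb _ (by linarith), hb _ (by linarith)⟩, hx4⟩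
  · rintro ⟨v, hv, rfl⟩
    have hn : Quaternion.normSq (halfQuaternion v) = 1 := by
      rw [normSq_halfQuaternion, (Finset.mem_filter.1 hv).2]
      norm_num
    exact ⟨isHurwitz_halfQuaternion hn, hn⟩

theorem card_binaryTetrahedralGroup : Nat.card binaryTetrahedralGroup = 24 := by
  let f : binaryTetrahedralGroup → {x : ℍ[ℚ] | IsHurwitz x ∧ Quaternion.normSq x = 1} :=
    fun u ↦ ⟨u.1.1, u.2⟩
  have hf : Function.Bijective f := by
    constructor
    · intro u v h
      exact Subtype.ext (Units.ext (congrArg Subtype.val h))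
    · rintro ⟨x, hx⟩
      have hx0 : x ≠ 0 := by
        rintro rfl
        simpa using hx.2
      exact ⟨⟨Units.mk0 x hx0, hx⟩, rfl⟩
  rw [Nat.card_congr (Equiv.ofBijective f hf), Nat.card_coe_set_eq, setOf_hurwitz_units_eq,
    Set.ncard_image_of_injective _ halfQuaternion_injective, Set.ncard_coe_finset,
    card_hurwitzUnitCoords]

instance : Finite binaryTetrahedralGroup :=
  Nat.finite_of_card_ne_zero (by rw [card_binaryTetrahedralGroup]; norm_num)

theorem normSq_eq_one_of_pow_eq_one {x : ℍ[ℚ]} {n : ℕ} (hn : 0 < n) (hx : x ^ n = 1) :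
    Quaternion.normSq x = 1 := by
  have h : Quaternion.normSq x ^ n = 1 := by rw [← map_pow, hx, map_one]
  exact (pow_eq_one_iff_of_nonneg Quaternion.normSq_nonneg hn.ne').1 h

/-- A quaternion of norm one satisfies `x² + 1 = 2 re(x) x`; comparison with the cyclotomic relation
makes `2 re(x)` an integer. -/
theorem exists_two_mul_re_eq_int {x : ℍ[ℚ]} {n : ℕ} (hn : 0 < n) (hx : x ^ n = 1) :
    ∃ t : ℤ, 2 * x.re = t := by
  have h1 := normSq_eq_one_of_pow_eq_one hn hx
  have h2 : x * x + 1 = (2 * x.re) • x := by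
    rw [Quaternion.normSq_def'] at h1
    ext <;> simp
    · linear_combination -h1
    all_goals ring
  obtain ⟨t, -, -, ht⟩ := exists_int_mul_self_add_one_eq (D := ℍ[ℚ]) hn hx (s := 2 * x.re) (t := -1)
    (by rw [← h2]; simp)
  refine ⟨t, ?_⟩
  have hx0 : x ≠ 0 := by
    rintro rfl
    simp at h1
  have h3 : (2 * x.re - t) • x = 0 := by
    rw [sub_smul, ← h2, ht, sub_eq_zero]
    ext <;> simp
  rcases smul_eq_zero.1 h3 with h | h
  · linarith
  · exact absurd h hx0

/-- The quaternion `i`. -/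
def unitI : ℍ[ℚ] := ⟨0, 1, 0, 0⟩

/-- The quaternion `j`. -/
def unitJ : ℍ[ℚ] := ⟨0, 0, 1, 0⟩

theorem unitI_coords : unitI.re = 0 ∧ unitI.imI = 1 ∧ unitI.imJ = 0 ∧ unitI.imK = 0 :=
  ⟨rfl, rfl, rfl, rfl⟩

theorem unitJ_coords : unitJ.re = 0 ∧ unitJ.imI = 0 ∧ unitJ.imJ = 1 ∧ unitJ.imK = 0 :=
  ⟨rfl, rfl, rfl, rfl⟩

/-- A finite group of rational quaternions containing `i` and `j` consists of Hurwitz units. -/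
theorem le_binaryTetrahedralGroup {H : Subgroup ℍ[ℚ]ˣ} [Finite H] {i j : ℍ[ℚ]ˣ} (hi : i ∈ H)
    (hj : j ∈ H) (hi' : (i : ℍ[ℚ]) = unitI) (hj' : (j : ℍ[ℚ]) = unitJ) :
    H ≤ binaryTetrahedralGroup := by
  have hfin : ∀ u ∈ H, ∃ n, 0 < n ∧ (u : ℍ[ℚ]) ^ n = 1 := by
    intro u hu
    obtain ⟨n, hn, h⟩ := (isOfFinOrder_of_finite (⟨u, hu⟩ : H)).exists_pow_eq_one
    refine ⟨n, hn, ?_⟩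
    have := congrArg (fun v : H ↦ ((v : ℍ[ℚ]ˣ) : ℍ[ℚ])) h
    simpa using this
  have htr : ∀ u ∈ H, ∃ t : ℤ, 2 * (u : ℍ[ℚ]).re = t := by
    intro u hu
    obtain ⟨n, hn, h⟩ := hfin u hu
    exact exists_two_mul_re_eq_int hn h
  intro u hu
  -- Up to sign, the traces of `u`, `u i`, `u j`, `u i j` are the doubled coordinates of `u`.
  obtain ⟨a, ha⟩ := htr u hu
  obtain ⟨b, hb⟩ := htr _ (H.mul_mem hu hi)
  obtain ⟨c, hc⟩ := htr _ (H.mul_mem hu hj)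
  obtain ⟨d, hd⟩ := htr _ (H.mul_mem hu (H.mul_mem hi hj))
  obtain ⟨n, hn, hun⟩ := hfin u hu
  have hnorm := normSq_eq_one_of_pow_eq_one hn hun
  have hu' : (u : ℍ[ℚ]) = halfQuaternion (a, -b, -c, -d) := by
    simp only [Units.val_mul, hi', hj', Quaternion.re_mul, Quaternion.imI_mul,
      Quaternion.imJ_mul, Quaternion.imK_mul, unitI_coords, unitJ_coords] at hb hc hd
    ext <;> simp only [halfQuaternion] <;> push_cast <;> linarith
  rw [hu'] at hnorm
  exact ⟨hu' ▸ isHurwitz_halfQuaternion hnorm, hu' ▸ hnorm⟩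

end BinaryTetrahedral

/-! ### Groups containing anticommuting square roots of `-1`. -/

section QuaternionPair

open QuaternionAlgebra (Basis)

variable {D : Type*} [Ring D] [IsDomain D] [Algebra ℚ D]

theorem exists_algEquiv_quaternion (hD : Module.finrank ℚ D = 4)
    (q : Basis (R := ℚ) D (-1) 0 (-1)) :
    ∃ e : ℍ[ℚ] ≃ₐ[ℚ] D, e unitI = q.i ∧ e unitJ = q.j := by
  let f : ℍ[ℚ] →ₐ[ℚ] D := q.liftHom
  refine ⟨AlgEquiv.ofBijective f (q.liftHom_bijective hD (by norm_num) (by norm_num)), ?_, ?_⟩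
  · change q.lift ⟨0, 1, 0, 0⟩ = q.i
    simp [Basis.lift]
  · change q.lift ⟨0, 0, 1, 0⟩ = q.j
    simp [Basis.lift]

theorem neg_one_ne_one' {D : Type*} [Ring D] [CharZero D] : (-1 : D) ≠ 1 := by
  intro h
  have : (2 : D) = 0 := by
    rw [← one_add_one_eq_two]
    nth_rw 1 [← h]
    simp
  exact two_ne_zero this

/-- A finite group of units containing anticommuting square roots of `-1` is the binary
tetrahedral group or the quaternion group. -/
theorem equiv_of_anticommute_mem (hD : Module.finrank ℚ D = 4) (G : Subgroup Dˣ) [Finite G]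
    {i j : Dˣ} (hi : i ∈ G) (hj : j ∈ G) (hi2 : (i * i : D) = -1) (hj2 : (j * j : D) = -1)
    (hij : (j * i : D) = -(i * j)) :
    Nonempty (G ≃* binaryTetrahedralGroup) ∨ Nonempty (G ≃* QuaternionGroup 2) := by
  have : CharZero D := algebraRat.charZero D
  let q : Basis (R := ℚ) D (-1) 0 (-1) :=
    quaternionBasis (by simpa using hi2) (by simpa using hj2) hij
  obtain ⟨e, he1, he2⟩ := exists_algEquiv_quaternion hD q
  let E : Dˣ ≃* ℍ[ℚ]ˣ := Units.mapEquiv (e.symm : D ≃* ℍ[ℚ])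
  let H := G.map (E : Dˣ →* ℍ[ℚ]ˣ)
  let ψ : G ≃* H := E.subgroupMap G
  have : Finite H := Finite.of_equiv G ψ.toEquiv
  have hle : H ≤ binaryTetrahedralGroup := by
    refine le_binaryTetrahedralGroup (i := E i) (j := E j) ⟨i, hi, rfl⟩ ⟨j, hj, rfl⟩ ?_ ?_
    · change e.symm (i : D) = unitI
      rw [AlgEquiv.symm_apply_eq, he1]; rfl
    · change e.symm (j : D) = unitJ
      rw [AlgEquiv.symm_apply_eq, he2]; rfl
  have hval : ∀ {u v : G}, ((u : Dˣ) : D) = (v : Dˣ) → u = v := fun h ↦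
    Subtype.ext (Units.ext h)
  have hi4 : orderOf (⟨i, hi⟩ : G) = 2 * 2 := by
    refine orderOf_eq_prime_pow (p := 2) (n := 1) ?_ ?_
    · intro h
      have := congrArg (fun v : G ↦ ((v : Dˣ) : D)) h
      simp [sq, hi2] at this
      exact neg_one_ne_one' this
    · apply hval
      have : (i : D) ^ 4 = i * i * (i * i) := by noncomm_ring
      simp [this, hi2]
  obtain ⟨φ, hφ, -⟩ := QuaternionGroup.exists_injective_hom (n := 2) (x := (⟨j, hj⟩ : G)) hi4
    (hval (by simp [sq, hi2, hj2])) (by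
      rw [eq_mul_inv_iff_mul_eq]
      apply hval
      push_cast
      rw [mul_assoc, hij, mul_neg, ← mul_assoc, hi2]
      simp) (by
      intro h
      have h' : (i * j : D) = j * i := congrArg (fun v : G ↦ ((v : Dˣ) : D)) h
      rw [hij, self_eq_neg] at h'
      exact mul_ne_zero i.ne_zero j.ne_zero h')
  -- The order of `G` is a multiple of 8 dividing 24, so `G` is either the embedded `Q₈` or all
  -- Hurwitz units.
  have hcardQ : Nat.card (QuaternionGroup 2) = 8 := by
    rw [Nat.card_eq_fintype_card, QuaternionGroup.card]
  have h8 : 8 ∣ Nat.card G := by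
    rw [← hcardQ]
    exact Subgroup.card_dvd_of_injective φ hφ
  have hGH : Nat.card G = Nat.card H := Nat.card_congr ψ.toEquiv
  have h24 : Nat.card G ∣ 24 := by
    rw [← card_binaryTetrahedralGroup, hGH]
    exact Subgroup.card_dvd_of_le hle
  obtain ⟨k, hk⟩ := h8
  rw [hk] at h24
  have hk3 : k ∣ 3 := Nat.dvd_of_mul_dvd_mul_left (by norm_num) (h24 : 8 * k ∣ 8 * 3)
  rcases (Nat.dvd_prime Nat.prime_three).1 hk3 with rfl | rfl
  · right
    exact ⟨(MulEquiv.ofBijective φ (hφ.bijective_of_nat_card_le (by rw [hk, hcardQ]))).symm⟩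
  · left
    have hHT : H = binaryTetrahedralGroup :=
      Subgroup.eq_of_le_of_card_ge hle (by rw [card_binaryTetrahedralGroup, ← hGH, hk])
    exact ⟨ψ.trans (MulEquiv.subgroupCongr hHT)⟩

end QuaternionPair

/-! ### Trace calculus and groups without a quaternion pair. -/

section Traces

variable {G D : Type*} [Group G] [Ring D]

/-- The element `g` has trace `t` in the representation `ρ` by elements of norm one. -/
def HasTrace (ρ : G →* D) (g : G) (t : ℤ) : Prop := ρ g + ρ g⁻¹ = t

variable {ρ : G →* D} {g h x y : G} {s t : ℤ}

theorem hasTrace_iff_mul_self : HasTrace ρ g t ↔ ρ g * ρ g + 1 = t * ρ g := by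
  have h1 : ρ g * ρ g⁻¹ = 1 := by rw [← map_mul, mul_inv_cancel, map_one]
  have h2 : ρ g⁻¹ * ρ g = 1 := by rw [← map_mul, inv_mul_cancel, map_one]
  constructor
  · intro h
    rw [← (show ρ g + ρ g⁻¹ = t from h), add_mul, h2]
  · intro h
    have h3 := congrArg (· * ρ g⁻¹) h
    simp only [add_mul, mul_assoc, h1, mul_one, one_mul] at h3
    exact h3

theorem HasTrace.inv (h : HasTrace ρ g t) : HasTrace ρ g⁻¹ t := by
  rw [HasTrace, inv_inv, add_comm]
  exact h

theorem HasTrace.conj (hg : HasTrace ρ g t) (h : G) : HasTrace ρ (h * g * h⁻¹) t := by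
  have h1 : ρ h * ρ h⁻¹ = 1 := by rw [← map_mul, mul_inv_cancel, map_one]
  have h2 : (h * g * h⁻¹)⁻¹ = h * g⁻¹ * h⁻¹ := by group
  rw [HasTrace, h2]
  simp only [map_mul]
  rw [← add_mul, ← mul_add, (show ρ g + ρ g⁻¹ = t from hg), ← (Int.cast_commute t (ρ h)).eq,
    mul_assoc, h1, mul_one]

theorem hasTrace_zero_iff : HasTrace ρ g 0 ↔ ρ g * ρ g = -1 := by
  rw [hasTrace_iff_mul_self, Int.cast_zero, zero_mul, eq_neg_iff_add_eq_zero]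

theorem HasTrace.map_inv_of_zero (h : HasTrace ρ g 0) : ρ g⁻¹ = -ρ g := by
  have : ρ g + ρ g⁻¹ = ((0 : ℤ) : D) := h
  rw [Int.cast_zero] at this
  exact (neg_eq_of_add_eq_zero_right this).symm

theorem HasTrace.anticommute (hx : HasTrace ρ x 0) (hy : HasTrace ρ y 0)
    (hxy : HasTrace ρ (x * y) 0) : ρ y * ρ x = -(ρ x * ρ y) := by
  have := hxy.map_inv_of_zero
  rw [mul_inv_rev, map_mul, map_mul, hx.map_inv_of_zero, hy.map_inv_of_zero, neg_mul_neg] at this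
  exact this

theorem HasTrace.pow_three (hρ : Function.Injective ρ) (h : HasTrace ρ g (-1)) : g ^ 3 = 1 := by
  apply hρ
  rw [hasTrace_iff_mul_self] at h
  have h1 : ρ g * ρ g = -1 - ρ g := by
    rw [eq_sub_iff_add_eq, eq_neg_iff_add_eq_zero, add_assoc, add_comm (ρ g), ← add_assoc, h]
    simp
  rw [map_pow, map_one, pow_succ, sq, h1, sub_mul, h1]
  noncomm_ring

/-- The trace `ρ y + ρ y⁻¹` is an integer, hence central, and factors out of the sum of the two
traces. -/
theorem HasTrace.add_eq_mul [CharZero D] {a b : ℤ} (hx : HasTrace ρ x a) (hy : HasTrace ρ y b)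
    (hs : HasTrace ρ (x * y) s) (ht : HasTrace ρ (x * y⁻¹) t) : s + t = a * b := by
  have h : ((s + t : ℤ) : D) = ((a * b : ℤ) : D) := by
    push_cast
    rw [← (show _ = (s : D) from hs), ← (show _ = (t : D) from ht)]
    have hy' : ρ y + ρ y⁻¹ = b := hy
    calc ρ (x * y) + ρ (x * y)⁻¹ + (ρ (x * y⁻¹) + ρ (x * y⁻¹)⁻¹)
        = ρ x * (ρ y + ρ y⁻¹) + (ρ y + ρ y⁻¹) * ρ x⁻¹ := by
          simp only [mul_inv_rev, inv_inv, map_mul]; noncomm_ring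
      _ = (ρ x + ρ x⁻¹) * b := by
          rw [hy', (Int.cast_commute b (ρ x⁻¹)).eq, add_mul]
      _ = a * b := by rw [(show ρ x + ρ x⁻¹ = a from hx)]
  exact_mod_cast h

theorem hasTrace_one : HasTrace ρ 1 2 := by
  rw [HasTrace, inv_one, map_one]
  norm_num

theorem HasTrace.eq_one [IsDomain D] (hρ : Function.Injective ρ) (h : HasTrace ρ g 2) : g = 1 := by
  apply hρ
  rw [hasTrace_iff_mul_self] at h
  have : (ρ g - 1) * (ρ g - 1) = 0 := by
    have : (ρ g - 1) * (ρ g - 1) = ρ g * ρ g + 1 - (2 : ℤ) * ρ g := by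
      push_cast; noncomm_ring
    rw [this, h, sub_self]
  rw [map_one]
  exact sub_eq_zero.1 (mul_self_eq_zero.1 this)

theorem HasTrace.map_eq_neg_one [IsDomain D] (h : HasTrace ρ g (-2)) : ρ g = -1 := by
  rw [hasTrace_iff_mul_self] at h
  have : (ρ g + 1) * (ρ g + 1) = 0 := by
    have : (ρ g + 1) * (ρ g + 1) = ρ g * ρ g + 1 - (-2 : ℤ) * ρ g := by
      push_cast; noncomm_ring
    rw [this, h, sub_self]
  exact eq_neg_of_add_eq_zero_left (mul_self_eq_zero.1 this)

/-- Every element of the group has an integral trace between `-2` and `2`. -/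
def HasBoundedTraces (ρ : G →* D) : Prop := ∀ g, ∃ t : ℤ, -2 ≤ t ∧ t ≤ 2 ∧ HasTrace ρ g t

/-- No two elements of the group are anticommuting square roots of `-1`. -/
def HasNoQuaternionPair (ρ : G →* D) : Prop :=
  ∀ x y, HasTrace ρ x 0 → HasTrace ρ y 0 → ¬HasTrace ρ (x * y) 0

theorem HasTrace.mul_self_of_one [CharZero D] (hT : HasBoundedTraces ρ) (h : HasTrace ρ g 1) :
    HasTrace ρ (g * g) (-1) := by
  obtain ⟨s, -, -, hs⟩ := hT (g * g)
  have := h.add_eq_mul h hs (mul_inv_cancel g ▸ hasTrace_one)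
  have hs' : s = -1 := by linarith
  exact hs' ▸ hs

/-- Trace 1 means `g² - g + 1 = 0`, so `ρ g` has cube `-1`; this reduces order six to order three up
to sign. -/
theorem HasTrace.map_eq_neg_of_one (h : HasTrace ρ g 1) :
    ρ g = -ρ (g * g * (g * g)) := by
  rw [hasTrace_iff_mul_self, Int.cast_one, one_mul, ← eq_sub_iff_add_eq] at h
  simp only [map_mul]
  rw [h]
  have : (ρ g - 1) * (ρ g - 1) = ρ g * ρ g - ρ g - ρ g + 1 := by noncomm_ring
  rw [this, h]
  abel

/-- Elements of order three commute unless the group contains a quaternion pair. -/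
theorem HasTrace.commute_of_neg_one [CharZero D] [IsDomain D]
    (hρ : Function.Injective ρ) (hT : HasBoundedTraces ρ)
    (hQ : HasNoQuaternionPair ρ) (hx : HasTrace ρ x (-1)) (hy : HasTrace ρ y (-1)) :
    x * y = y * x := by
  have key : ∀ {y}, HasTrace ρ y (-1) → ¬HasTrace ρ (x * y) 0 := by
    intro y hy hz
    refine hQ _ _ hz (hz.conj x) ?_
    have hx3 := hx.pow_three hρ
    have hy3 := hy.pow_three hρ
    -- The product of `xy` and its conjugate by `x` is a conjugate of `(xy)⁻¹`, so trace 0 for `xy`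
    -- would give a quaternion pair.
    have h1 : x * y * (x * (x * y) * x⁻¹) = x * y⁻¹ * (x * y)⁻¹ * (x * y⁻¹)⁻¹ := by
      have hx' : x * x = x⁻¹ := by rw [eq_inv_iff_mul_eq_one, ← hx3, pow_succ, sq]
      have hy' : y⁻¹ * y⁻¹ = y := by rw [← mul_inv_rev, inv_eq_iff_mul_eq_one, ← hy3, pow_succ, sq]
      calc x * y * (x * (x * y) * x⁻¹) = x * y * (x * x) * y * x⁻¹ := by group
        _ = x * (y⁻¹ * y⁻¹) * x⁻¹ * y * x⁻¹ := by rw [hx', hy']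
        _ = _ := by group
    rw [h1]
    exact hz.inv.conj _
  obtain ⟨s, hs1, hs2, hs⟩ := hT (x * y)
  obtain ⟨t, ht1, ht2, ht⟩ := hT (x * y⁻¹)
  have hst := hx.add_eq_mul hy hs ht
  have hs0 : s ≠ 0 := by rintro rfl; exact key hy hs
  have ht0 : t ≠ 0 := by rintro rfl; exact key hy.inv ht
  -- The sum of the traces is `(-1)(-1) = 1`, both lie in `[-2, 2]`, and neither is 0.
  have : s = 2 ∨ t = 2 := by omega
  rcases this with rfl | rfl
  · have := eq_inv_of_mul_eq_one_left (hs.eq_one hρ)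
    rw [this]; group
  · rw [mul_inv_eq_one.1 (ht.eq_one hρ)]

/-- Both elements are roots of `X² - tX + 1`, which factors as `(X - ω)(X - ω⁻¹)` over elements
commuting with `ω`. -/
theorem eq_or_eq_inv_of_commute [IsDomain D] (hρ : Function.Injective ρ) {ω : G}
    (hω : HasTrace ρ ω t) (hg : HasTrace ρ g t) (hc : g * ω = ω * g) : g = ω ∨ g = ω⁻¹ := by
  have h1 : (ρ g - ρ ω) * (ρ g - ρ ω⁻¹) = 0 := by
    have hωi : ρ ω * ρ ω⁻¹ = 1 := by rw [← map_mul, mul_inv_cancel, map_one]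
    have hc' : ρ ω * ρ g = ρ g * ρ ω := by rw [← map_mul, ← map_mul, hc]
    have : (ρ g - ρ ω) * (ρ g - ρ ω⁻¹) = ρ g * ρ g + 1 - ρ g * (ρ ω + ρ ω⁻¹) := by
      rw [sub_mul, mul_sub, mul_sub, hωi, hc', mul_add]; abel
    rw [this, (show ρ ω + ρ ω⁻¹ = t from hω), hasTrace_iff_mul_self.1 hg,
      (Int.cast_commute t (ρ g)).eq, sub_self]
  rcases mul_eq_zero.1 h1 with h | h
  · exact Or.inl (hρ (sub_eq_zero.1 h))
  · exact Or.inr (hρ (sub_eq_zero.1 h))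

/-- The centralizer of an element `ω` of order three consists of the elements `±ω ^ k`. -/
theorem exists_eq_zpow_of_commute [CharZero D] [IsDomain D] (hρ : Function.Injective ρ)
    (hT : HasBoundedTraces ρ) {ω : G}
    (hω : HasTrace ρ ω (-1)) (hc : g * ω = ω * g) :
    ∃ k : ℤ, ρ g = ρ (ω ^ k) ∨ ρ g = -ρ (ω ^ k) := by
  obtain ⟨t, ht1, ht2, ht⟩ := hT g
  -- If `g² = -1`, then `(gω)² = -ω⁻¹` has trace 1, so the trace of `gω` would be an integer with
  -- square 3.
  have hne : t ≠ 0 := by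
    rintro rfl
    obtain ⟨s, -, -, hs⟩ := hT (g * ω)
    have h1 : HasTrace ρ (g * ω * (g * ω)) 1 := by
      have h2 : g * ω * (g * ω) = g * g * (ω * ω) := by
        rw [mul_assoc, ← mul_assoc ω g ω, ← hc]; group
      have h3 : ω * ω = ω⁻¹ := by
        rw [eq_inv_iff_mul_eq_one, ← hω.pow_three hρ, pow_succ, sq]
      have h4 : ρ (g * ω * (g * ω)) = -ρ ω⁻¹ := by
        rw [h2, h3, map_mul, map_mul, hasTrace_zero_iff.1 ht, neg_one_mul]
      rw [hasTrace_iff_mul_self, h4, neg_mul_neg, hasTrace_iff_mul_self.1 hω.inv]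
      simp
    have h2 := hs.add_eq_mul hs h1 (mul_inv_cancel (g * ω) ▸ hasTrace_one)
    have : s < 2 := by nlinarith
    have : -2 < s := by nlinarith
    interval_cases s <;> omega
  have hcase : t = -2 ∨ t = -1 ∨ t = 1 ∨ t = 2 := by omega
  rcases hcase with rfl | rfl | rfl | rfl
  · exact ⟨0, Or.inr (by simpa using ht.map_eq_neg_one)⟩
  · rcases eq_or_eq_inv_of_commute hρ hω ht hc with rfl | rfl
    · exact ⟨1, Or.inl (by simp)⟩
    · exact ⟨-1, Or.inl (by simp)⟩
  · have h2 := ht.map_eq_neg_of_one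
    rcases eq_or_eq_inv_of_commute hρ hω (ht.mul_self_of_one hT)
      (by rw [mul_assoc, hc, ← mul_assoc, hc, mul_assoc]) with h | h
    · exact ⟨2, Or.inr (by rw [h2, h, ← zpow_two])⟩
    · exact ⟨-2, Or.inr (by rw [h2, h, ← zpow_two, inv_zpow'])⟩
  · exact ⟨0, Or.inl (by simp [ht.eq_one hρ])⟩

theorem hasTrace_neg_two_of_map_eq (h : ρ g = -1) : HasTrace ρ g (-2) := by
  rw [hasTrace_iff_mul_self, h]
  norm_num

theorem mul_comm_of_map_eq_neg_one (hρ : Function.Injective ρ) (h : ρ g = -1) (x : G) :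
    g * x = x * g := by
  apply hρ
  rw [map_mul, map_mul, h, neg_one_mul, mul_neg_one]

/-- Without trace `-1` there is no trace 1 either (square it), so all elements other than `±1` have
trace 0. For noncommuting `x, y` the product is not `±1`, so they form a quaternion pair. -/
theorem exists_hasTrace_neg_one [CharZero D] [IsDomain D] (hρ : Function.Injective ρ)
    (hT : HasBoundedTraces ρ) (hQ : HasNoQuaternionPair ρ) (hxy : x * y ≠ y * x) :
    ∃ ω, HasTrace ρ ω (-1) := by
  by_contra! hno
  have key : ∀ g, HasTrace ρ g 0 ∨ g = 1 ∨ ρ g = -1 := by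
    intro g
    obtain ⟨t, ht1, ht2, ht⟩ := hT g
    interval_cases t
    · exact Or.inr (Or.inr ht.map_eq_neg_one)
    · exact absurd ht (hno g)
    · exact Or.inl ht
    · exact absurd (ht.mul_self_of_one hT) (hno _)
    · exact Or.inr (Or.inl (ht.eq_one hρ))
  have hx : HasTrace ρ x 0 := by
    rcases key x with h | rfl | h
    · exact h
    · simp at hxy
    · exact absurd (mul_comm_of_map_eq_neg_one hρ h y) hxy
  have hy : HasTrace ρ y 0 := by
    rcases key y with h | rfl | h
    · exact h
    · simp at hxy
    · exact absurd (mul_comm_of_map_eq_neg_one hρ h x).symm hxy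
  rcases key (x * y) with h | h | h
  · exact hQ x y hx hy h
  · rw [eq_inv_of_mul_eq_one_left h] at hxy
    simp at hxy
  · have hyx : y = x := by
      apply hρ
      rw [map_mul] at h
      have h1 : ρ x⁻¹ * (ρ x * ρ y) = ρ y := by
        rw [← mul_assoc, ← map_mul, inv_mul_cancel, map_one, one_mul]
      rw [← h1, h, mul_neg_one, hx.map_inv_of_zero, neg_neg]
    exact hxy (by rw [hyx])

/-- A nonabelian group with bounded traces and without quaternion pair is dicyclic of order 12. -/
theorem equiv_quaternionGroup_three [CharZero D] [IsDomain D] (hρ : Function.Injective ρ)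
    (hT : HasBoundedTraces ρ) (hQ : HasNoQuaternionPair ρ) (hxy : x * y ≠ y * x) :
    Nonempty (G ≃* QuaternionGroup 3) := by
  obtain ⟨ω, hω⟩ := exists_hasTrace_neg_one hρ hT hQ hxy
  have hω3 := hω.pow_three hρ
  have hconj : ∀ g, g * ω * g⁻¹ = ω ∨ g * ω * g⁻¹ = ω⁻¹ := fun g ↦
    eq_or_eq_inv_of_commute hρ hω (hω.conj g) ((hω.conj g).commute_of_neg_one hρ hT hQ hω)
  obtain ⟨x, hx⟩ : ∃ x, x * ω ≠ ω * x := by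
    by_contra! hall
    apply hxy
    apply hρ
    obtain ⟨k, hk⟩ := exists_eq_zpow_of_commute hρ hT hω (hall x)
    obtain ⟨l, hl⟩ := exists_eq_zpow_of_commute hρ hT hω (hall y)
    have hc : ρ (ω ^ k) * ρ (ω ^ l) = ρ (ω ^ l) * ρ (ω ^ k) := by
      rw [← map_mul, ← map_mul, ← zpow_add, ← zpow_add, add_comm]
    rw [map_mul, map_mul]
    rcases hk with hk | hk <;> rcases hl with hl | hl <;> rw [hk, hl] <;> simp [hc]
  have hxω : x * ω * x⁻¹ = ω⁻¹ := (hconj x).resolve_left fun h ↦ hx (mul_inv_eq_iff_eq_mul.1 h)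
  -- For every other trace, `x` is `±1` or `±` an element of order three, and so commutes with `ω`.
  have hx0 : HasTrace ρ x 0 := by
    obtain ⟨t, ht1, ht2, ht⟩ := hT x
    interval_cases t
    · exact absurd (mul_comm_of_map_eq_neg_one hρ ht.map_eq_neg_one ω) hx
    · exact absurd (ht.commute_of_neg_one hρ hT hQ hω) hx
    · exact ht
    · exfalso
      apply hx
      apply hρ
      have h2 := (ht.mul_self_of_one hT).commute_of_neg_one hρ hT hQ hω
      have h3 : Commute (x * x * (x * x)) ω := Commute.mul_left h2 h2
      rw [map_mul, map_mul, ht.map_eq_neg_of_one, neg_mul, mul_neg, ← map_mul, ← map_mul, h3.eq]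
    · rw [ht.eq_one hρ] at hx
      simp at hx
  have hm : ρ (x * x) = -1 := by rw [map_mul]; exact hasTrace_zero_iff.1 hx0
  have hmc := mul_comm_of_map_eq_neg_one hρ hm
  have hne := neg_one_ne_one' (D := D)
  -- Here `x * x` is the element of `G` acting as `-1`, so `ζ` acts as `-ω` and has order six.
  obtain ⟨ζ, hζ⟩ : ∃ ζ, ζ = x * x * ω := ⟨_, rfl⟩
  have hρζ : ρ ζ = -ρ ω := by rw [hζ, map_mul, hm, neg_one_mul]
  have hζ3 : ζ ^ 3 = x * x := by
    apply hρ
    rw [map_pow, hρζ, hm, Odd.neg_pow (by decide), ← map_pow, hω3, map_one]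
  have hζ2 : ζ ^ 2 = ω ^ 2 := by
    apply hρ
    rw [map_pow, hρζ, neg_sq, map_pow]
  have hζ4 : ζ ^ 4 = ω := by
    rw [show 4 = 2 * 2 from rfl, pow_mul, hζ2, ← pow_mul, show 2 * 2 = 3 + 1 from rfl, pow_add, hω3,
      one_mul, pow_one]
  have hω1 : ω ≠ 1 := by
    rintro rfl
    simp at hx
  have hord : orderOf ζ = 2 * 3 := by
    have h6 : ζ ^ 6 = 1 := by
      rw [show 6 = 2 * 3 from rfl, pow_mul, hζ2, ← pow_mul, mul_comm, pow_mul, hω3, one_pow]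
    have hdvd : orderOf ζ ∣ 6 := orderOf_dvd_of_pow_eq_one h6
    have h2 : ¬orderOf ζ ∣ 2 := by
      intro h
      rw [orderOf_dvd_iff_pow_eq_one, hζ2] at h
      apply hω1
      rw [← hω3, pow_succ, h, one_mul]
    have h3 : ¬orderOf ζ ∣ 3 := by
      intro h
      rw [orderOf_dvd_iff_pow_eq_one, hζ3] at h
      rw [h, map_one] at hm
      exact hne hm.symm
    have hle := Nat.le_of_dvd (by norm_num) hdvd
    interval_cases orderOf ζ <;> omega
  have hωx : ω * x = x * ω⁻¹ := by
    have h : x * ω⁻¹ * x⁻¹ = ω := by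
      have := congrArg Inv.inv hxω
      simpa [mul_assoc] using this
    exact (mul_inv_eq_iff_eq_mul.1 h).symm
  obtain ⟨φ, hφ, hφk⟩ := QuaternionGroup.exists_injective_hom (n := 3) (x := x) hord
    (by rw [hζ3, sq]) (by
      have hmi : (x * x)⁻¹ = x * x := by
        apply hρ
        rw [hm, (hasTrace_neg_two_of_map_eq hm).inv.map_eq_neg_one]
      rw [hζ, mul_inv_rev, hmi, mul_assoc, hωx, hmc, mul_assoc]) (by
      rw [hζ, mul_assoc, ← mul_assoc x, ← hmc x, mul_assoc (x * x)]
      intro h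
      exact hx (mul_left_cancel h).symm)
  -- As `ζ ^ 4 = ω` and `ζ ^ 3` acts as `-1`, the centralizer `{±ω ^ k}` is generated by `ζ`; any
  -- other element of `G` lies in the coset of `x`.
  have hcent : ∀ g, g * ω = ω * g → ∃ k : ℤ, g = ζ ^ k := by
    intro g hg
    obtain ⟨k, hk | hk⟩ := exists_eq_zpow_of_commute hρ hT hω hg
    · refine ⟨4 * k, hρ ?_⟩
      rw [hk, zpow_mul]
      norm_cast
      rw [hζ4]
    · refine ⟨3 + 4 * k, hρ ?_⟩
      rw [hk, zpow_add, zpow_mul]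
      norm_cast
      rw [hζ4, hζ3, map_mul, hm, neg_one_mul]
  have hsurj : Function.Surjective φ := by
    intro g
    rcases hconj g with h | h
    · obtain ⟨k, rfl⟩ := hcent g (mul_inv_eq_iff_eq_mul.1 h)
      exact ⟨_, (hφk k).1⟩
    · obtain ⟨k, hk⟩ := hcent (x⁻¹ * g) (by
        have h1 : g * ω = ω⁻¹ * g := mul_inv_eq_iff_eq_mul.1 h
        have h2 : x * ω = ω⁻¹ * x := mul_inv_eq_iff_eq_mul.1 hxω
        rw [mul_assoc, h1, ← mul_assoc, ← mul_assoc]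
        congr 1
        rw [inv_mul_eq_iff_eq_mul, ← mul_assoc, h2, mul_assoc, mul_inv_cancel, mul_one])
      exact ⟨.xa k, by rw [(hφk k).2, ← hk, mul_inv_cancel_left]⟩
  exact ⟨(MulEquiv.ofBijective φ ⟨hφ, hsurj⟩).symm⟩

/-- A finite abelian group of elements of a `ℚ`-algebra without zero divisors is cyclic. -/
theorem isCyclic_of_injective_of_commute {D : Type*} [Ring D] [IsDomain D] [Algebra ℚ D] [Finite G]
    {ρ : G →* D} (hρ : Function.Injective ρ) (hc : ∀ x y : G, x * y = y * x) : IsCyclic G := by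
  let K := Algebra.adjoin ℚ (Set.range ρ)
  have : IsMulCommutative K := Algebra.isMulCommutative_adjoin ℚ (by
    rintro _ ⟨x, rfl⟩ _ ⟨y, rfl⟩
    rw [← map_mul, ← map_mul, hc])
  let _ : CommRing K := { (inferInstance : Ring K) with mul_comm := mul_comm' }
  let f : G →* K := ρ.codRestrict K fun g ↦ Algebra.subset_adjoin ⟨g, rfl⟩
  have hf : Function.Injective f := fun x y h ↦ hρ (congrArg (Subtype.val : K → D) h)
  exact isCyclic_of_injective_ringHom (R := K) f hf

end Traces

/-! ### Classification of the finite subgroups. -/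

section Classification

open QuaternionAlgebra (Basis)

variable {D : Type*} [Ring D] [IsDomain D] [Algebra ℚ D]

/-- The image `z` of `a 1` satisfies `z² - z + 1 = 0`, so `2z - 1` squares to `-3`. The image of `xa
0` squares to `-1` and conjugates `z` to `1 - z`, so it anticommutes with `2z - 1`. -/
theorem hasQuaternionBasis_of_quaternionGroup_three {f : QuaternionGroup 3 →* D}
    (hf : Function.Injective f) : HasQuaternionBasis D (-1) (-3) := by
  have : CharZero D := algebraRat.charZero D
  have h3 : f (.a 3) = -1 := by
    have h : f (.a 3) * f (.a 3) = 1 := by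
      rw [← map_mul, ← map_one f]; rfl
    refine (mul_self_eq_one_iff.1 h).resolve_left fun h ↦ ?_
    rw [← map_one f] at h
    exact absurd (hf h) (by decide)
  have hz3 : f (.a 1) * f (.a 1) * f (.a 1) = -1 := by
    rw [← map_mul, ← map_mul, ← h3]; rfl
  have hz : f (.a 1) * f (.a 1) - f (.a 1) + 1 = 0 := by
    have h : (f (.a 1) + 1) * (f (.a 1) * f (.a 1) - f (.a 1) + 1) = 0 := by
      have : (f (.a 1) + 1) * (f (.a 1) * f (.a 1) - f (.a 1) + 1) =
          f (.a 1) * f (.a 1) * f (.a 1) + 1 := by noncomm_ring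
      rw [this, hz3, neg_add_cancel]
    refine (mul_eq_zero.1 h).resolve_left fun h ↦ ?_
    have h1 : f (.a 1) = f (.a 3) := by rw [h3]; exact eq_neg_of_add_eq_zero_left h
    exact absurd (hf h1) (by decide)
  have hz' : f (.a 1) * f (.a 1) = f (.a 1) - 1 := by
    rw [← sub_eq_zero, ← hz]; abel
  have hx : f (.xa 0) * f (.xa 0) = -1 := by
    rw [← map_mul, ← h3]; rfl
  have hxz : f (.a 1) * f (.xa 0) = f (.xa 0) * (1 - f (.a 1)) := by
    have h1 : f (.a 1) * f (.xa 0) = f (.xa 0) * f (.a 3 * (.a 1 * .a 1)) := by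
      rw [← map_mul, ← map_mul]; rfl
    rw [h1, map_mul, map_mul, h3, hz']
    congr 1; noncomm_ring
  refine ⟨quaternionBasis (i := f (.xa 0)) (j := 2 * f (.a 1) - 1) ?_ ?_ ?_⟩
  · rw [hx]; simp
  · have : (2 * f (.a 1) - 1) * (2 * f (.a 1) - 1) =
        4 * (f (.a 1) * f (.a 1)) - 4 * f (.a 1) + 1 := by
      noncomm_ring
    rw [this, hz']
    rw [mul_sub, sub_right_comm, sub_self, map_neg, map_ofNat]
    norm_num
  · rw [sub_mul, mul_assoc, hxz]
    noncomm_ring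

/-- The generators go to `ζ = (1 + j) / 2`, with `ζ ^ 3 = -1`, and `i`. Only noncommutativity of the
image is needed. -/
theorem exists_hom_quaternionGroup_three (hD : Module.finrank ℚ D = 4)
    (h : HasQuaternionBasis D (-1) (-3)) :
    ∃ f : QuaternionGroup 3 →* Dˣ, f (.a 1) * f (.xa 0) ≠ f (.xa 0) * f (.a 1) := by
  obtain ⟨q⟩ := h
  let ζ : ℍ[ℚ,-1,-3]ˣ := ⟨⟨1 / 2, 0, 1 / 2, 0⟩, ⟨1 / 2, 0, -1 / 2, 0⟩,
    by ext <;> simp <;> norm_num, by ext <;> simp <;> norm_num⟩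
  let x : ℍ[ℚ,-1,-3]ˣ := ⟨⟨0, 1, 0, 0⟩, ⟨0, -1, 0, 0⟩, by ext <;> simp, by ext <;> simp⟩
  have hζ3 : ζ ^ 3 = -1 := by
    apply Units.ext
    rw [pow_succ, sq]
    ext <;> simp [ζ] <;> norm_num
  obtain ⟨φ, hφ⟩ := QuaternionGroup.exists_hom (n := 3) (ζ := ζ) (x := x)
    (by rw [mul_comm, pow_mul, hζ3]; simp)
    (by
      rw [hζ3]
      apply Units.ext
      rw [sq]
      ext <;> simp [x])
    (by
      apply Units.ext
      ext <;> simp [x, ζ]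
      norm_num)
  refine ⟨(Units.map (q.liftHom : ℍ[ℚ,-1,-3] →* D)).comp φ, fun h ↦ ?_⟩
  have h1 : φ (.a 1) = ζ := by simpa using (hφ 1).1
  have h2 : φ (.xa 0) = x := by simpa using (hφ 0).2
  rw [← map_mul, ← map_mul] at h
  have h3 := Units.map_injective (q.liftHom_bijective hD (by norm_num) (by norm_num)).1 h
  rw [map_mul, map_mul, h1, h2] at h3
  have h4 := congrArg (fun u : ℍ[ℚ,-1,-3]ˣ ↦ (u : ℍ[ℚ,-1,-3]).imK) h3
  norm_num [ζ, x] at h4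

/-- The finite subgroups of the unit group of a quaternion division algebra over `ℚ`. -/
theorem finite_subgroup_classification [Algebra.IsCentral ℚ D] (hD : Module.finrank ℚ D = 4)
    (G : Subgroup Dˣ) [Finite G] :
    (HasQuaternionBasis D (-1) (-1) ∧
      (Nonempty (G ≃* binaryTetrahedralGroup) ∨ Nonempty (G ≃* QuaternionGroup 2))) ∨
    (HasQuaternionBasis D (-1) (-3) ∧ Nonempty (G ≃* QuaternionGroup 3)) ∨ IsCyclic G := by
  have : CharZero D := algebraRat.charZero D
  let ρ : G →* D := (Units.coeHom D).comp G.subtype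
  have hρ : Function.Injective ρ := fun x y h ↦ Subtype.ext (Units.ext h)
  have hT : HasBoundedTraces ρ := by
    intro g
    obtain ⟨n, hn, h⟩ := (isOfFinOrder_of_finite g).exists_pow_eq_one
    obtain ⟨s, t, hst⟩ := exists_quadratic_relation hD (ρ g)
    obtain ⟨t, h1, h2, h3⟩ := exists_int_mul_self_add_one_eq hn
      (by rw [← map_pow, h, map_one]) hst
    exact ⟨t, h1, h2, hasTrace_iff_mul_self.2 h3⟩
  by_cases hQ : HasNoQuaternionPair ρ
  · right
    by_cases hc : ∀ x y : G, x * y = y * x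
    · exact Or.inr (isCyclic_of_injective_of_commute hρ hc)
    · push Not at hc
      obtain ⟨x, y, hxy⟩ := hc
      obtain ⟨ψ⟩ := equiv_quaternionGroup_three hρ hT hQ hxy
      refine Or.inl ⟨?_, ⟨ψ⟩⟩
      exact hasQuaternionBasis_of_quaternionGroup_three
        (f := ρ.comp (ψ.symm : QuaternionGroup 3 →* G)) (hρ.comp ψ.symm.injective)
  · left
    rw [HasNoQuaternionPair] at hQ
    push Not at hQ
    obtain ⟨x, y, hx, hy, hxy⟩ := hQ
    have hxx : (x.1 * x.1 : D) = -1 := hasTrace_zero_iff.1 hx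
    have hyy : (y.1 * y.1 : D) = -1 := hasTrace_zero_iff.1 hy
    have hyx : (y.1 * x.1 : D) = -(x.1 * y.1) := hx.anticommute hy hxy
    exact ⟨⟨quaternionBasis (by simpa using hxx) (by simpa using hyy) hyx⟩,
      equiv_of_anticommute_mem hD G x.2 y.2 hxx hyy hyx⟩

end Classification

/-! ### Abelian normal subgroups and Jordan constants. -/

section Jordan

/-- `H` has an abelian normal subgroup of index at most `d`. -/
def HasAbelianNormal (H : Type*) [Group H] (d : ℕ) : Prop :=
  ∃ A : Subgroup H, A.Normal ∧ (∀ x ∈ A, ∀ y ∈ A, x * y = y * x) ∧ A.index ≤ d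

variable {H K : Type*} [Group H] [Group K] {d e : ℕ}

theorem HasAbelianNormal.of_equiv (h : HasAbelianNormal H d) (f : K ≃* H) :
    HasAbelianNormal K d := by
  obtain ⟨A, hA, hc, hi⟩ := h
  refine ⟨A.comap (f : K →* H), hA.comap _, fun x hx y hy ↦ f.injective ?_, ?_⟩
  · rw [map_mul, map_mul]
    exact hc _ hx _ hy
  · rwa [Subgroup.index_comap_of_surjective _ f.surjective]

theorem HasAbelianNormal.mono (h : HasAbelianNormal H d) (hde : d ≤ e) : HasAbelianNormal H e := by
  obtain ⟨A, hA, hc, hi⟩ := h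
  exact ⟨A, hA, hc, hi.trans hde⟩

theorem hasAbelianNormal_of_isCyclic [IsCyclic H] : HasAbelianNormal H 1 := by
  let := IsCyclic.commGroup (α := H)
  exact ⟨⊤, inferInstance, fun x _ y _ ↦ mul_comm x y, by simp⟩

theorem hasAbelianNormal_quaternionGroup (n : ℕ) [NeZero n] :
    HasAbelianNormal (QuaternionGroup n) 2 := by
  have hidx : (Subgroup.zpowers (QuaternionGroup.a 1 : QuaternionGroup n)).index = 2 := by
    have h := Subgroup.card_mul_index (Subgroup.zpowers (QuaternionGroup.a 1 : QuaternionGroup n))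
    rw [Nat.card_zpowers, QuaternionGroup.orderOf_a_one, Nat.card_eq_fintype_card,
      QuaternionGroup.card] at h
    have hn := NeZero.pos n
    exact Nat.eq_of_mul_eq_mul_left (by omega : 0 < 2 * n) (by linarith)
  refine ⟨_, Subgroup.normal_of_index_eq_two hidx, ?_, hidx.le⟩
  rintro x ⟨k, rfl⟩ y ⟨l, rfl⟩
  simp only [← zpow_add, add_comm]

/-- The element `-1` of the binary tetrahedral group. -/
def binaryTetrahedralNegOne : binaryTetrahedralGroup :=
  ⟨-1, ⟨-1, 0, 0, 0, by simp⟩, by simp⟩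

theorem coe_binaryTetrahedralNegOne :
    ((binaryTetrahedralNegOne : ℍ[ℚ]ˣ) : ℍ[ℚ]) = -1 := rfl

theorem binaryTetrahedralGroup_ext {u v : binaryTetrahedralGroup}
    (h : ((u : ℍ[ℚ]ˣ) : ℍ[ℚ]) = (v : ℍ[ℚ]ˣ)) : u = v :=
  Subtype.ext (Units.ext h)

theorem orderOf_binaryTetrahedralNegOne : orderOf binaryTetrahedralNegOne = 2 := by
  rw [orderOf_eq_prime_iff]
  constructor
  · apply binaryTetrahedralGroup_ext
    simp [coe_binaryTetrahedralNegOne]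
  · intro h
    have h1 := congrArg (fun u : binaryTetrahedralGroup ↦ ((u : ℍ[ℚ]ˣ) : ℍ[ℚ])) h
    have : CharZero ℍ[ℚ] := algebraRat.charZero ℍ[ℚ]
    exact neg_one_ne_one' (D := ℍ[ℚ]) h1

theorem hasAbelianNormal_binaryTetrahedralGroup : HasAbelianNormal binaryTetrahedralGroup 12 := by
  refine ⟨Subgroup.zpowers binaryTetrahedralNegOne, ?_, ?_, ?_⟩
  · have hc : ∀ g, binaryTetrahedralNegOne * g = g * binaryTetrahedralNegOne := fun g ↦
      binaryTetrahedralGroup_ext (by simp [coe_binaryTetrahedralNegOne])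
    refine ⟨?_⟩
    rintro _ ⟨k, rfl⟩ g
    have : Commute g (binaryTetrahedralNegOne ^ k) :=
      (show Commute g binaryTetrahedralNegOne from (hc g).symm).zpow_right k
    rw [this.eq, mul_inv_cancel_right]
    exact ⟨k, rfl⟩
  · rintro x ⟨k, rfl⟩ y ⟨l, rfl⟩
    simp only [← zpow_add, add_comm]
  · have h := Subgroup.card_mul_index (Subgroup.zpowers binaryTetrahedralNegOne)
    rw [Nat.card_zpowers, orderOf_binaryTetrahedralNegOne, card_binaryTetrahedralGroup] at h
    omega

theorem coe_inv_binaryTetrahedralGroup (u : binaryTetrahedralGroup) :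
    ((u⁻¹ : binaryTetrahedralGroup) : ℍ[ℚ]ˣ).val = star (u : ℍ[ℚ]ˣ).val := by
  change (((u : ℍ[ℚ]ˣ)⁻¹ : ℍ[ℚ]ˣ) : ℍ[ℚ]) = _
  apply Units.inv_eq_of_mul_eq_one_right
  rw [Quaternion.self_mul_star, u.2.2, Quaternion.coe_one]

theorem exists_mem_binaryTetrahedralGroup {v : ℤ × ℤ × ℤ × ℤ}
    (hv : v.1 ^ 2 + v.2.1 ^ 2 + v.2.2.1 ^ 2 + v.2.2.2 ^ 2 = 4) :
    ∃ u : binaryTetrahedralGroup, ((u : ℍ[ℚ]ˣ) : ℍ[ℚ]) = halfQuaternion v := by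
  have hn : Quaternion.normSq (halfQuaternion v) = 1 := by
    rw [normSq_halfQuaternion, hv]; norm_num
  have h0 : halfQuaternion v ≠ 0 := by
    intro h
    simp [h] at hn
  exact ⟨⟨Units.mk0 _ h0, isHurwitz_halfQuaternion hn, hn⟩, rfl⟩

/-- An abelian normal subgroup of the binary tetrahedral group is contained in `{1, -1}`. -/
theorem coe_eq_of_mem_abelian_normal {A : Subgroup binaryTetrahedralGroup} (hA : A.Normal)
    (hc : ∀ x ∈ A, ∀ y ∈ A, x * y = y * x) {a : binaryTetrahedralGroup} (ha : a ∈ A) :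
    a = 1 ∨ a = binaryTetrahedralNegOne := by
  obtain ⟨i, hi⟩ := exists_mem_binaryTetrahedralGroup (v := (0, 2, 0, 0)) (by norm_num)
  obtain ⟨w, hw⟩ := exists_mem_binaryTetrahedralGroup (v := (1, 1, 1, 1)) (by norm_num)
  -- Normality puts each conjugate of `a` in the abelian group `A`, so `a` commutes with it.
  have key : ∀ g : binaryTetrahedralGroup,
      (g : ℍ[ℚ]ˣ).val * (a : ℍ[ℚ]ˣ).val * star (g : ℍ[ℚ]ˣ).val * (a : ℍ[ℚ]ˣ).val =
      (a : ℍ[ℚ]ˣ).val * ((g : ℍ[ℚ]ˣ).val * (a : ℍ[ℚ]ˣ).val * star (g : ℍ[ℚ]ˣ).val) := by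
    intro g
    have h := congrArg (fun u : binaryTetrahedralGroup ↦ ((u : ℍ[ℚ]ˣ) : ℍ[ℚ]))
      (hc _ (hA.conj_mem a ha g) a ha)
    simpa [← coe_inv_binaryTetrahedralGroup] using h
  have h1 := key i
  have h2 := key w
  have hnorm := a.2.2
  rw [hi] at h1
  rw [hw] at h2
  obtain ⟨z, hz⟩ : ∃ z : ℍ[ℚ], z = (a : ℍ[ℚ]ˣ).val := ⟨_, rfl⟩
  rw [← hz] at h1 h2 hnorm
  -- For imaginary part `(p, q, s)`, conjugation by `i` negates `q, s`, giving `pq = ps = 0`.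
  -- Conjugation by `w` permutes the coordinates cyclically, giving `q² = ps`, `s² = pq`, `p² = qs`.
  have hps := congrArg QuaternionAlgebra.imJ h1
  have hpq := congrArg QuaternionAlgebra.imK h1
  have hq := congrArg QuaternionAlgebra.imI h2
  have hs := congrArg QuaternionAlgebra.imJ h2
  have hp := congrArg QuaternionAlgebra.imK h2
  simp only [Quaternion.re_mul, Quaternion.imI_mul, Quaternion.imJ_mul, Quaternion.imK_mul,
    Quaternion.re_star, Quaternion.imI_star, Quaternion.imJ_star,
    Quaternion.imK_star] at hps hpq hq hs hp
  norm_num [halfQuaternion] at hps hpq hq hs hp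
  replace hps : z.imI * z.imK = 0 := by linarith only [hps]
  replace hpq : z.imI * z.imJ = 0 := by linarith only [hpq]
  replace hq : z.imJ = 0 := pow_eq_zero_iff two_ne_zero |>.1 (by linarith only [hq, hps])
  replace hs : z.imK = 0 := pow_eq_zero_iff two_ne_zero |>.1 (by linarith only [hs, hpq])
  replace hp : z.imI = 0 := pow_eq_zero_iff two_ne_zero |>.1
    (by linarith only [hp, mul_eq_zero_of_left hq z.imK])
  rw [Quaternion.normSq_def', hp, hq, hs] at hnorm
  rcases sq_eq_one_iff.1 (by linarith only [hnorm] : z.re ^ 2 = 1) with h | h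
  · left
    apply binaryTetrahedralGroup_ext
    rw [← hz]
    ext <;> simp [h, hp, hq, hs]
  · right
    apply binaryTetrahedralGroup_ext
    rw [← hz, coe_binaryTetrahedralNegOne]
    ext <;> simp [h, hp, hq, hs]

theorem HasAbelianNormal.twelve_le (h : HasAbelianNormal binaryTetrahedralGroup d) : 12 ≤ d := by
  obtain ⟨A, hA, hc, hi⟩ := h
  have hle : A ≤ Subgroup.zpowers binaryTetrahedralNegOne := fun a ha ↦ by
    rcases coe_eq_of_mem_abelian_normal hA hc ha with rfl | rfl
    · exact one_mem _
    · exact Subgroup.mem_zpowers _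
  have hcard : Nat.card A ≤ 2 := by
    rw [← orderOf_binaryTetrahedralNegOne, ← Nat.card_zpowers]
    exact Subgroup.card_le_of_le hle
  have h := A.card_mul_index
  rw [card_binaryTetrahedralGroup] at h
  nlinarith

theorem IsJordanBound.hasAbelianNormal (h : IsJordanBound H d) [Finite K] {f : K →* H}
    (hf : Function.Injective f) : HasAbelianNormal K d :=
  have : Finite f.range := Finite.of_equiv _ (MonoidHom.ofInjective hf).toEquiv
  HasAbelianNormal.of_equiv (h f.range this) (MonoidHom.ofInjective hf)

theorem HasAbelianNormal.mul_comm (h : HasAbelianNormal H 1) [Finite H] (x y : H) :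
    x * y = y * x := by
  obtain ⟨A, -, hc, hi⟩ := h
  have hA : A = ⊤ := Subgroup.index_eq_one.1 (le_antisymm hi
    (Nat.one_le_iff_ne_zero.2 A.index_ne_zero_of_finite))
  subst hA
  exact hc x trivial y trivial

theorem jordanConstant_eq (h0 : 0 < d) (h : IsJordanBound H d)
    (hmin : ∀ e, 0 < e → IsJordanBound H e → d ≤ e) : jordanConstant H = d :=
  IsLeast.csInf_eq ⟨⟨h0, h⟩, fun e he ↦ hmin e he.1 he.2⟩

end Jordan

/-! ### Values of the Jordan constant. -/

section Main

variable {D : Type*} [Ring D] [IsDomain D] [Algebra ℚ D] [Algebra.IsCentral ℚ D]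

theorem isJordanBound_twelve (hD : Module.finrank ℚ D = 4) : IsJordanBound Dˣ 12 := by
  intro G hG
  rcases finite_subgroup_classification hD G with ⟨-, (⟨⟨e⟩⟩ | ⟨⟨e⟩⟩)⟩ | ⟨-, ⟨e⟩⟩ | hG
  · exact hasAbelianNormal_binaryTetrahedralGroup.of_equiv e
  · exact ((hasAbelianNormal_quaternionGroup 2).of_equiv e).mono (by norm_num)
  · exact ((hasAbelianNormal_quaternionGroup 3).of_equiv e).mono (by norm_num)
  · exact hasAbelianNormal_of_isCyclic.mono (by norm_num)

theorem jordanConstant_eq_twelve (hD : Module.finrank ℚ D = 4)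
    (h : HasQuaternionBasis D (-1) (-1)) : jordanConstant Dˣ = 12 := by
  refine jordanConstant_eq (by norm_num) (isJordanBound_twelve hD) fun d _ hd ↦ ?_
  obtain ⟨q⟩ := h
  obtain ⟨e, -⟩ := exists_algEquiv_quaternion hD q
  exact (hd.hasAbelianNormal (f := (Units.map (e : ℍ[ℚ] →* D)).comp
    binaryTetrahedralGroup.subtype)
    ((Units.map_injective e.injective).comp Subtype.val_injective)).twelve_le

theorem jordanConstant_eq_two (hD : Module.finrank ℚ D = 4)
    (h : ¬ HasQuaternionBasis D (-1) (-1)) (h' : HasQuaternionBasis D (-1) (-3)) :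
    jordanConstant Dˣ = 2 := by
  refine jordanConstant_eq (by norm_num) (fun G hG ↦ ?_) fun d hd0 hd ↦ ?_
  · rcases finite_subgroup_classification hD G with ⟨h₁, -⟩ | ⟨-, ⟨e⟩⟩ | hG
    · exact absurd h₁ h
    · exact (hasAbelianNormal_quaternionGroup 3).of_equiv e
    · exact hasAbelianNormal_of_isCyclic.mono (by norm_num)
  · by_contra hlt
    obtain rfl : d = 1 := by omega
    obtain ⟨f, hf⟩ := exists_hom_quaternionGroup_three hD h'
    have hfin : Finite f.range := Finite.of_surjective _ f.rangeRestrict_surjective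
    have hcomm := HasAbelianNormal.mul_comm (hd f.range hfin)
      (f.rangeRestrict (.a 1)) (f.rangeRestrict (.xa 0))
    exact hf (congrArg Subtype.val hcomm)

theorem jordanConstant_eq_one (hD : Module.finrank ℚ D = 4)
    (h : ¬ HasQuaternionBasis D (-1) (-1)) (h' : ¬ HasQuaternionBasis D (-1) (-3)) :
    jordanConstant Dˣ = 1 := by
  refine jordanConstant_eq (by norm_num) (fun G hG ↦ ?_) fun d hd0 _ ↦ hd0
  rcases finite_subgroup_classification hD G with ⟨h₁, -⟩ | ⟨h₁, -⟩ | hG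
  · exact absurd h₁ h
  · exact absurd h₁ h'
  · exact hasAbelianNormal_of_isCyclic

end Main

theorem mainTheorem2 {D : Type*} [DivisionRing D] [Algebra ℚ D] [Algebra.IsCentral ℚ D]
    (hD : Module.finrank ℚ D = 4) :
    IsJordanGroup Dˣ ∧
    (jordanConstant Dˣ = 12 ↔ ramificationSet D = {placeTwo, .infinite}) ∧
    (jordanConstant Dˣ = 2 ↔ ramificationSet D = {placeThree, .infinite}) ∧
    (jordanConstant Dˣ = 1 ↔ ramificationSet D ≠ {placeTwo, .infinite} ∧
      ramificationSet D ≠ {placeThree, .infinite}) ∧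
    ∀ G : Subgroup Dˣ, Finite G →
      Nonempty (G ≃* binaryTetrahedralGroup) ∨ Nonempty (G ≃* QuaternionGroup 3) ∨
        Nonempty (G ≃* QuaternionGroup 2) ∨ IsCyclic G := by
  rw [ne_eq, ne_eq, ramificationSet_eq_two_iff hD, ramificationSet_eq_three_iff hD]
  have hexcl : ¬ (HasQuaternionBasis D (-1) (-1) ∧ HasQuaternionBasis D (-1) (-3)) := fun h ↦
    pair_placeTwo_ne (((ramificationSet_eq_two_iff hD).2 h.1).symm.trans
      ((ramificationSet_eq_three_iff hD).2 h.2))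
  refine ⟨⟨12, by norm_num, isJordanBound_twelve hD⟩, ?_⟩
  rw [← and_assoc, ← and_assoc]
  refine ⟨?_, fun G hG ↦ ?_⟩
  · by_cases h : HasQuaternionBasis D (-1) (-1)
    · have h' : ¬ HasQuaternionBasis D (-1) (-3) := fun h' ↦ hexcl ⟨h, h'⟩
      simp [jordanConstant_eq_twelve hD h, h, h']
    · by_cases h' : HasQuaternionBasis D (-1) (-3)
      · simp [jordanConstant_eq_two hD h h', h, h']
      · simp [jordanConstant_eq_one hD h h', h, h']
  · rcases finite_subgroup_classification hD G with ⟨-, h | h⟩ | ⟨-, h⟩ | h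
    · exact Or.inl h
    · exact Or.inr (Or.inr (Or.inl h))
    · exact Or.inr (Or.inl h)
    · exact Or.inr (Or.inr (Or.inr h))
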